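/- For a partition $\lambda$ of a nonnegative integer $n$, the rank of $\lambda$ is its largest part minus its number of parts (the empty partition of $0$ has largest part $0$). The crank of $\lambda$ is its largest part if $1$ is not a part of $\lambda$, and is $e(k)-k$ if $1$ occurs exactly $k\ge 1$ times in $\lambda$, where $e(k)$ is the number of parts of $\lambda$ strictly larger than $k$. For $n\neq 1$ let $M(m,n)$ be the number of partitions of $n$ with crank $m$, and put $M(0,1)=-1$, $M(1,1)=M(-1,1)=1$ and $M(m,1)=0$ otherwise. Let $N(t,m,n)$ be the number of partitions of $n$ with rank congruent to $t$ modulo $m$, and let $M(t,m,n)=\sum_{k\equiv t \ (\mathrm{mod}\ m)}M(k,n)$. Define $$N_{(6)}(n)=\sum_{t=0,\pm1}N(t,6,n)-\sum_{t=3,\pm2}N(t,6,n),\qquad M_{(2)}(n)=M(0,2,n)-M(1,2,n).$$ Let $p_3(n)$ be the number of partitions of $n$ into parts congruent to $\pm1$ modulo $3$, and let $(a;q)_\infty=\prod_{j=0}^\infty(1-aq^j)$. Then for every complex number $q$ with $|q|<1$ both series below converge absolutely and $$\sum_{n=0}^\infty N_{(6)}(n)q^n=\frac{(q^3;q^3)_\infty}{(q;q)_\infty}\sum_{n=0}^\infty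 M_{(2)}(n)q^{3n}=\frac{(q^3;q^3)_\infty^2}{(q;q)_\infty(-q^3;q^3)_\infty^2}.$$ Hence, for every integer $n\ge0$, $$N_{(6)}(n)=\sum_{0\le 3k\le n}M_{(2)}(k)\,p_3(n-3k).$$ -/

import Mathlib

open Finset

namespace RankCrank

/-- The largest part of a partition (`0` for the empty partition of `0`). -/
def largestPart {n : ℕ} (p : n.Partition) : ℕ := p.parts.sup

/-- Rank of a partition: its largest part minus its number of parts. -/
def rank {n : ℕ} (p : n.Partition) : ℤ := (largestPart p : ℤ) - (Multiset.card p.parts : ℤ)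

/-- Crank of a partition: the largest part if `1` does not appear; if `1` appears `k ≥ 1` times,
the number of parts strictly larger than `k`, minus `k`. -/
def crank {n : ℕ} (p : n.Partition) : ℤ :=
  if 1 ∉ p.parts then (largestPart p : ℤ)
  else (Multiset.card (p.parts.filter (fun i => p.parts.count 1 < i)) : ℤ) - (p.parts.count 1 : ℤ)

/-- `M(m, n)`: the number of partitions of `n` with crank `m` for `n ≠ 1`, with the usual convention
`M(0, 1) = -1`, `M(1, 1) = M(-1, 1) = 1` and `M(m, 1) = 0` otherwise. -/
def crankCount (m : ℤ) (n : ℕ) : ℤ :=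
  if n = 1 then (if m = 0 then -1 else if m = 1 ∨ m = -1 then 1 else 0)
  else ((univ.filter (fun p : n.Partition => crank p = m)).card : ℤ)

/-- Only finitely many values `M(m, n)` are nonzero for a given `n`, so the finite-support sum in
the definition of `crankCountMod` is a genuine sum. -/
theorem finite_support_crankCount (n : ℕ) : (Function.support (fun m => crankCount m n)).Finite := by
  refine ((univ.image (fun p : n.Partition => crank p)) ∪ {0, 1, -1}).finite_toSet.subset ?_
  intro m hm
  by_contra h
  simp only [coe_union, Set.mem_union, mem_coe, mem_image, mem_univ, true_and, mem_insert,
    mem_singleton, not_or, not_exists] at h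
  obtain ⟨h1, h2, h3, h4⟩ := h
  apply hm
  simp [crankCount, h1, h2, h3, h4]

/-- `N(t, m, n)`: the number of partitions of `n` with rank congruent to `t` modulo `m`. -/
def rankCountMod (t m : ℤ) (n : ℕ) : ℤ :=
  ((univ.filter (fun p : n.Partition => rank p ≡ t [ZMOD m])).card : ℤ)

/-- `M(t, m, n)`: the number of partitions of `n` with crank congruent to `t` modulo `m`, that is
the sum of `M(k, n)` over all integers `k` congruent to `t` modulo `m`. -/
noncomputable def crankCountMod (t m : ℤ) (n : ℕ) : ℤ :=
  ∑ᶠ (k : ℤ) (_ : k ≡ t [ZMOD m]), crankCount k n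

/-- The signed count `N_{(6)}(n)`. -/
def rankSix (n : ℕ) : ℤ :=
  ∑ t ∈ ({0, 1, -1} : Finset ℤ), rankCountMod t 6 n -
    ∑ t ∈ ({3, 2, -2} : Finset ℤ), rankCountMod t 6 n

/-- The signed count `M_{(2)}(n)`. -/
noncomputable def crankTwo (n : ℕ) : ℤ := crankCountMod 0 2 n - crankCountMod 1 2 n

/-- `p₃(n)`: the number of partitions of `n` into parts congruent to `±1` modulo `3`. -/
def pThree (n : ℕ) : ℤ :=
  ((univ.filter (fun p : n.Partition =>
    ∀ i ∈ p.parts, (i : ℤ) ≡ 1 [ZMOD 3] ∨ (i : ℤ) ≡ -1 [ZMOD 3])).card : ℤ)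

/-- `(a; q)_∞ = ∏_{j ≥ 0} (1 - a q^j)`. -/
noncomputable def qPoch (a q : ℂ) : ℂ := ∏' j : ℕ, (1 - a * q ^ j)

/-- The product defining `(a; q)_∞` converges for `|q| < 1`. -/
theorem multipliable_qPoch (a : ℂ) {q : ℂ} (hq : ‖q‖ < 1) :
    Multipliable (fun j : ℕ => 1 - a * q ^ j) := by
  have h : Summable (fun j : ℕ => ‖-(a * q ^ j)‖) := by
    simpa [norm_mul, norm_pow] using
      (summable_geometric_of_lt_one (norm_nonneg q) hq).mul_left ‖a‖
  simpa [sub_eq_add_neg] using multipliable_one_add_of_summable h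

end RankCrank

/-! Everything rests on one Bailey pair. For `z * w = 1`, `|z| = 1`, the numbers 1/((zq)_n (wq)_n)
expand as the sum over r ≤ n of α_r/((q)_{n-r} (q)_{n+r}), with α_r = `baileyAlpha z w q r`
(`bailey_pair`). It is used twice. Letting n → ∞ gives Σ α_r = (q)_∞² / ((zq)_∞ (wq)_∞)
(`hasSum_baileyAlpha`). Summing against q^{n²} gives the Durfee square form of the rank generating
function as (q)_∞⁻¹ Σ α_r q^{r²} (`hasSum_durfee_square`); the Rogers–Fine identity ties this to the
sum over the largest part, hence to the combinatorial rank (`hasSum_rank`).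

For a primitive sixth root of unity ζ, the sign in N_(6) is (2ζ^m + 2ζ^{-m} - (-1)^m)/3 at rank m,
so its series is 4/3 of the rank series at ζ minus 1/3 of that at -1. Term by term, this combination
of the α_r(q) q^{r²} collapses to α_r(q³) at z = w = -1, because (1+y)(1-y+y²) = 1+y³. The first use
of the pair, with q³ for q, then evaluates the sum as a product (`hasSum_rankSix`).

The series of M_(2) is computed directly: partitions are sorted by their number of ones, and the
q-binomial theorem sums the pieces to (q)_∞/(-q)_∞² (`hasSum_crankTwo`). The product for p_3 is
elementary, and the convolution formula follows by comparing coefficients. -/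

namespace RankCrank

open Filter Topology

/-! ### Finite and infinite q-Pochhammer symbols -/

/-- The finite `q`-Pochhammer symbol `(a; q)_n`. -/
def poch (a q : ℂ) (n : ℕ) : ℂ := ∏ j ∈ range n, (1 - a * q ^ j)

@[simp] theorem poch_zero (a q : ℂ) : poch a q 0 = 1 := by simp [poch]

theorem poch_succ (a q : ℂ) (n : ℕ) : poch a q (n + 1) = poch a q n * (1 - a * q ^ n) :=
  prod_range_succ _ _

theorem poch_succ' (a q : ℂ) (n : ℕ) : poch a q (n + 1) = (1 - a) * poch (a * q) q n := by
  rw [poch, prod_range_succ', mul_comm]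
  simp [poch, pow_succ', mul_assoc]

theorem one_sub_ne_zero_of_norm {x : ℂ} (hx : ‖x‖ < 1) : 1 - x ≠ 0 := by
  intro h
  rw [← sub_eq_zero.mp h] at hx
  simp at hx

theorem norm_mul_pow_lt {a q : ℂ} (ha : ‖a‖ < 1) (hq : ‖q‖ < 1) (n : ℕ) : ‖a * q ^ n‖ < 1 := by
  rw [norm_mul, norm_pow]
  exact (mul_le_of_le_one_right (norm_nonneg a) (pow_le_one₀ (norm_nonneg q) hq.le)).trans_lt ha

theorem poch_ne_zero {a q : ℂ} (ha : ‖a‖ < 1) (hq : ‖q‖ < 1) (n : ℕ) : poch a q n ≠ 0 :=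
  prod_ne_zero_iff.mpr fun j _ => one_sub_ne_zero_of_norm (norm_mul_pow_lt ha hq j)

theorem tendsto_poch (a : ℂ) {q : ℂ} (hq : ‖q‖ < 1) :
    Tendsto (poch a q) atTop (𝓝 (qPoch a q)) :=
  (multipliable_qPoch a hq).hasProd.tendsto_prod_nat

theorem summable_norm_mul_pow (a : ℂ) {q : ℂ} (hq : ‖q‖ < 1) :
    Summable fun j : ℕ => ‖-(a * q ^ j)‖ := by
  simpa [norm_mul, norm_pow] using
    (summable_geometric_of_lt_one (norm_nonneg q) hq).mul_left ‖a‖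

theorem qPoch_ne_zero {a q : ℂ} (ha : ‖a‖ < 1) (hq : ‖q‖ < 1) : qPoch a q ≠ 0 := by
  have h := tprod_one_add_ne_zero_of_summable (f := fun j : ℕ => -(a * q ^ j))
    (fun j => by
      rw [← sub_eq_add_neg]
      exact one_sub_ne_zero_of_norm (norm_mul_pow_lt ha hq j)) (summable_norm_mul_pow a hq)
  simpa [qPoch, sub_eq_add_neg] using h

theorem qPoch_eq_poch_mul (a : ℂ) {q : ℂ} (hq : ‖q‖ < 1) (n : ℕ) :
    qPoch a q = poch a q n * qPoch (a * q ^ n) q := by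
  refine tendsto_nhds_unique ((tendsto_poch a hq).comp (tendsto_add_atTop_nat n)) ?_
  refine ((tendsto_poch (a * q ^ n) hq).const_mul (poch a q n)).congr fun m => ?_
  simp only [Function.comp_apply, poch]
  rw [add_comm m n, prod_range_add]
  congr 1
  exact prod_congr rfl fun j _ => by ring

theorem exists_norm_poch_le (a : ℂ) {q : ℂ} (hq : ‖q‖ < 1) : ∃ C, ∀ n, ‖poch a q n‖ ≤ C := by
  obtain ⟨C, hC⟩ := (tendsto_poch a hq).norm.bddAbove_range
  exact ⟨C, fun n => hC ⟨n, rfl⟩⟩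

theorem exists_norm_inv_poch_le {a q : ℂ} (ha : ‖a‖ < 1) (hq : ‖q‖ < 1) :
    ∃ C, ∀ n, ‖(poch a q n)⁻¹‖ ≤ C := by
  obtain ⟨C, hC⟩ := ((tendsto_poch a hq).inv₀ (qPoch_ne_zero ha hq)).norm.bddAbove_range
  exact ⟨C, fun n => hC ⟨n, rfl⟩⟩

theorem tendsto_pow_zero {q : ℂ} (hq : ‖q‖ < 1) : Tendsto (fun n : ℕ => q ^ n) atTop (𝓝 0) :=
  tendsto_pow_atTop_nhds_zero_of_norm_lt_one hq

/-! ### The q-binomial theorem and Durfee rectangles -/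

/-- The `q`-binomial theorem. -/
theorem hasSum_qBinomial (a : ℂ) {q t : ℂ} (hq : ‖q‖ < 1) (ht : ‖t‖ < 1) :
    HasSum (fun n => poch a q n / poch q q n * t ^ n) (qPoch (a * t) q / qPoch t q) := by
  obtain ⟨A, hA⟩ := exists_norm_poch_le a hq
  obtain ⟨B, hB⟩ := exists_norm_inv_poch_le hq hq
  have hA0 : 0 ≤ A := (norm_nonneg _).trans (hA 0)
  have hbound : ∀ n, ‖poch a q n / poch q q n‖ ≤ A * B := fun n => by
    rw [div_eq_mul_inv, norm_mul]
    exact mul_le_mul (hA n) (hB n) (norm_nonneg _) hA0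
  have hsum : ∀ s : ℂ, ‖s‖ < 1 → Summable fun n => poch a q n / poch q q n * s ^ n := fun s hs => by
    refine Summable.of_norm_bounded (g := fun n => A * B * ‖s‖ ^ n)
      ((summable_geometric_of_lt_one (norm_nonneg s) hs).mul_left _) fun n => ?_
    rw [norm_mul, norm_pow]
    exact mul_le_mul_of_nonneg_right (hbound n) (by positivity)
  set F : ℂ → ℂ := fun s => ∑' n, poch a q n / poch q q n * s ^ n with hF
  -- The coefficients satisfy c_{n+1}(1 - q^{n+1}) = c_n(1 - a q^n), which is this q-difference
  -- equation. Iterating it drives the argument to 0, where `F` equals 1.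
  have hstep : ∀ s : ℂ, ‖s‖ < 1 → (1 - s) * F s = (1 - a * s) * F (s * q) := fun s hs => by
    have hsq : ‖s * q‖ < 1 := by simpa using norm_mul_pow_lt hs hq 1
    have e1 := (hsum s hs).tsum_eq_zero_add
    have e2 := (hsum (s * q) hsq).tsum_eq_zero_add
    have k1 := ((summable_nat_add_iff 1).mpr (hsum s hs)).hasSum
    have k2 := ((summable_nat_add_iff 1).mpr (hsum (s * q) hsq)).hasSum
    have k3 := ((hsum s hs).hasSum).mul_left s
    have k4 := ((hsum (s * q) hsq).hasSum).mul_left (a * s)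
    have k5 := ((k1.sub k2).sub k3).add k4
    have k0 : ∀ n, poch a q (n + 1) / poch q q (n + 1) * s ^ (n + 1)
        - poch a q (n + 1) / poch q q (n + 1) * (s * q) ^ (n + 1)
        - s * (poch a q n / poch q q n * s ^ n)
        + a * s * (poch a q n / poch q q n * (s * q) ^ n) = 0 := fun n => by
      have h1 := poch_ne_zero hq hq n
      have h2 : 1 - q * q ^ n ≠ 0 := one_sub_ne_zero_of_norm (norm_mul_pow_lt hq hq n)
      rw [poch_succ, poch_succ, mul_pow, mul_pow, pow_succ q n]
      generalize q ^ n = x at *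
      rw [mul_comm q x] at *
      field_simp
      ring
    simp only [k0] at k5
    have k6 := k5.unique hasSum_zero
    simp only [poch_zero, pow_zero, div_one, mul_one] at e1 e2
    simp only [hF]
    linear_combination e1 - e2 + k6
  have hiter : ∀ N, poch t q N * F t = poch (a * t) q N * F (t * q ^ N) := fun N => by
    induction N with
    | zero => simp
    | succ N ih =>
      have := hstep (t * q ^ N) (norm_mul_pow_lt ht hq N)
      rw [poch_succ, poch_succ, pow_succ, ← mul_assoc t]
      linear_combination (1 - t * q ^ N) * ih + poch (a * t) q N * this
  have hlim : Tendsto (fun N => F (t * q ^ N)) atTop (𝓝 1) := by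
    have h0 : (∑' n, if n = 0 then (1 : ℂ) else 0) = 1 := by simp
    rw [← h0]
    refine tendsto_tsum_of_dominated_convergence (bound := fun n => A * B * ‖t‖ ^ n)
      ((summable_geometric_of_lt_one (norm_nonneg t) ht).mul_left _) (fun n => ?_)
      (Eventually.of_forall fun N n => ?_)
    · rcases n with _ | n
      · simp
      · have h1 := (((tendsto_pow_zero hq).const_mul t).pow (n + 1)).const_mul
          (poch a q (n + 1) / poch q q (n + 1))
        simpa using h1
    · rw [norm_mul, norm_pow]
      refine mul_le_mul (hbound n) (pow_le_pow_left₀ (norm_nonneg _) ?_ n) (by positivity)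
        ((norm_nonneg _).trans (hbound 0))
      rw [norm_mul, norm_pow]
      exact mul_le_of_le_one_right (norm_nonneg t) (pow_le_one₀ (norm_nonneg q) hq.le)
  have hfin : qPoch t q * F t = qPoch (a * t) q * 1 :=
    tendsto_nhds_unique ((tendsto_poch t hq).mul_const _)
      (((tendsto_poch (a * t) hq).mul hlim).congr fun N => (hiter N).symm)
  have hne := qPoch_ne_zero ht hq
  have : qPoch (a * t) q / qPoch t q = F t := by
    rw [div_eq_iff hne]
    linear_combination -hfin
  rw [this]
  exact (hsum t ht).hasSum

/-- Cauchy's identity for Durfee rectangles. -/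
theorem hasSum_durfee {q : ℂ} (hq : ‖q‖ < 1) (k : ℕ) :
    HasSum (fun m => q ^ (m ^ 2 + k * m) / (poch q q m * poch q q (m + k))) (qPoch q q)⁻¹ := by
  obtain ⟨B, hB⟩ := exists_norm_inv_poch_le hq hq
  have hB0 : 0 ≤ B := (norm_nonneg _).trans (hB 0)
  have hbound : ∀ k m, ‖q ^ (m ^ 2 + k * m) / (poch q q m * poch q q (m + k))‖
      ≤ B * B * ‖q‖ ^ m := fun k m => by
    rw [div_eq_mul_inv, mul_inv, norm_mul, norm_mul, norm_pow, mul_comm]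
    refine mul_le_mul (mul_le_mul (hB _) (hB _) (norm_nonneg _) hB0)
      (pow_le_pow_of_le_one (norm_nonneg q) hq.le ?_) (by positivity) (by positivity)
    nlinarith [Nat.zero_le (k * m), Nat.le_self_pow two_ne_zero m]
  have hgeo : Summable fun m : ℕ => B * B * ‖q‖ ^ m :=
    (summable_geometric_of_lt_one (norm_nonneg q) hq).mul_left _
  have hsum : ∀ k, Summable fun m => q ^ (m ^ 2 + k * m) / (poch q q m * poch q q (m + k)) :=
    fun k => Summable.of_norm_bounded hgeo (hbound k)
  set G : ℕ → ℂ := fun k => ∑' m, q ^ (m ^ 2 + k * m) / (poch q q m * poch q q (m + k)) with hG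
  -- The sum does not depend on k: the difference of consecutive sums telescopes to -`V`, which
  -- tends to 0. As k → ∞ only the term m = 0 survives, with value 1/(q)_∞.
  have hstep : ∀ k, G k = G (k + 1) := fun k => by
    set V : ℕ → ℂ := fun m =>
      q ^ (m ^ 2 + k * m) / (poch q q m * poch q q (m + k)) * (1 - q ^ m) with hV
    have hV0 : Tendsto V atTop (𝓝 0) := by
      have := (hsum k).tendsto_atTop_zero.mul ((tendsto_pow_zero hq).const_sub 1)
      simpa using this
    have h1 := ((hsum k).hasSum.sub (hsum (k + 1)).hasSum).tendsto_sum_nat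
    have h2 : ∀ N, ∑ m ∈ range N, (q ^ (m ^ 2 + k * m) / (poch q q m * poch q q (m + k))
        - q ^ (m ^ 2 + (k + 1) * m) / (poch q q m * poch q q (m + (k + 1)))) = - V N := fun N => by
      induction N with
      | zero => simp [hV]
      | succ N ih =>
        rw [sum_range_succ, ih]
        simp only [hV]
        have e1 : N + 1 + k = N + k + 1 := by ring
        have e2 : N + (k + 1) = N + k + 1 := by ring
        rw [e1, e2, poch_succ q q N, poch_succ q q (N + k)]
        have h1 := poch_ne_zero hq hq N
        have h2 := poch_ne_zero hq hq (N + k)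
        have h3 : 1 - q * q ^ N ≠ 0 := one_sub_ne_zero_of_norm (norm_mul_pow_lt hq hq N)
        have h4 : 1 - q * q ^ (N + k) ≠ 0 := one_sub_ne_zero_of_norm (norm_mul_pow_lt hq hq _)
        have e3 : q ^ ((N + 1) ^ 2 + k * (N + 1))
            = q ^ (N ^ 2 + k * N) * (q ^ N * (q * q ^ (N + k))) := by ring
        have e4 : q ^ (N ^ 2 + (k + 1) * N) = q ^ (N ^ 2 + k * N) * q ^ N := by ring
        rw [e3, e4, pow_succ q N]
        generalize q ^ (N ^ 2 + k * N) = y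
        generalize q ^ N = x at *
        generalize q ^ (N + k) = u at *
        rw [mul_comm q x] at *
        field_simp
        ring
    have h3 := tendsto_nhds_unique h1 ((hV0.neg).congr fun N => (h2 N).symm)
    rw [neg_zero] at h3
    exact sub_eq_zero.mp h3
  have hconst : ∀ j, G k = G (j + k) := fun j => by
    induction j with
    | zero => simp
    | succ j ih => rw [ih, hstep, add_right_comm]
  have hlim : Tendsto (fun j => G (j + k)) atTop (𝓝 (qPoch q q)⁻¹) := by
    have h0 : (∑' n, if n = 0 then (qPoch q q)⁻¹ else 0) = (qPoch q q)⁻¹ := by simp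
    rw [← h0]
    refine Tendsto.comp (g := G) (y := atTop) ?_ (tendsto_add_atTop_nat k)
    refine tendsto_tsum_of_dominated_convergence hgeo (fun m => ?_)
      (Eventually.of_forall fun N n => hbound N n)
    have hp : Tendsto (fun j => (poch q q (m + j))⁻¹) atTop (𝓝 (qPoch q q)⁻¹) := by
      refine ((tendsto_poch q hq).comp ?_).inv₀ (qPoch_ne_zero hq hq)
      simpa [add_comm] using tendsto_add_atTop_nat m
    rcases m with _ | m
    · simpa using hp
    · have hz : Tendsto (fun j : ℕ => q ^ (j * (m + 1))) atTop (𝓝 0) := by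
        have := (tendsto_pow_zero hq).pow (m + 1)
        simpa [← pow_mul] using this
      have := (hz.const_mul (q ^ ((m + 1) ^ 2) * (poch q q (m + 1))⁻¹)).mul hp
      simp only [mul_zero, zero_mul] at this
      simp only [Nat.add_eq_zero_iff, one_ne_zero, and_false, if_false]
      refine this.congr fun j => ?_
      rw [pow_add, div_eq_mul_inv, mul_inv]
      ring
  have hfin : G k = (qPoch q q)⁻¹ :=
    tendsto_nhds_unique (tendsto_const_nhds.congr hconst) hlim
  rw [← hfin]
  exact (hsum k).hasSum

/-! ### The Bailey pair and its two consequences -/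

/-- The sequence `α` of the Bailey pair whose `β` is `1 / ((zq; q)_n (wq; q)_n)`, `z w = 1`. -/
noncomputable def baileyAlpha (z w q : ℂ) (r : ℕ) : ℂ :=
  if r = 0 then 1 else
    (-1) ^ r * q ^ (r + 1).choose 2 * (1 + q ^ r) * ((1 - z) * (1 - w)) /
      ((1 - z * q ^ r) * (1 - w * q ^ r))

theorem choose_two_succ (r : ℕ) : (r + 1).choose 2 = r + r.choose 2 := by
  rw [Nat.choose_succ_succ' r 1, Nat.choose_one_right]

/-- The sum telescopes once multiplied by 1 - q^{N+1}. The restriction R ≤ N keeps the subtraction N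
- R genuine; the last term r = N is added separately in `sum_alternating`. -/
theorem sum_alternating_aux {q : ℂ} (hq : ‖q‖ < 1) (N R : ℕ) (hR : R ≤ N) :
    (∑ r ∈ range R, (-1) ^ (r + 1) * q ^ (r + 1).choose 2 * (1 + q ^ (r + 1)) /
        (poch q q (N - r) * poch q q (N + 2 + r))) * (1 - q ^ (N + 1)) =
      (-1) ^ R * q ^ (R + 1).choose 2 / (poch q q (N - R) * poch q q (N + 1 + R)) -
        1 / (poch q q N * poch q q (N + 1)) := by
  induction R with
  | zero => simp
  | succ R ih =>
    rw [sum_range_succ, add_mul, ih (by omega)]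
    obtain ⟨d, rfl⟩ : ∃ d, N = R + 1 + d := ⟨N - (R + 1), by omega⟩
    have e1 : R + 1 + d - R = d + 1 := by omega
    have e2 : R + 1 + d - (R + 1) = d := by omega
    have e3 : R + 1 + d + 1 + R = R + 1 + d + R + 1 := by omega
    have e4 : R + 1 + d + 2 + R = R + 1 + d + R + 1 + 1 := by omega
    have e5 : R + 1 + d + 1 + (R + 1) = R + 1 + d + R + 1 + 1 := by omega
    rw [e1, e2, e3, e4, e5, poch_succ q q d, poch_succ q q (R + 1 + d + R + 1),
      choose_two_succ (R + 1)]
    have h1 := poch_ne_zero hq hq d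
    have h2 := poch_ne_zero hq hq (R + 1 + d + R + 1)
    have h3 : 1 - q * q ^ d ≠ 0 := one_sub_ne_zero_of_norm (norm_mul_pow_lt hq hq _)
    have h4 : 1 - q * q ^ (R + 1 + d + R + 1) ≠ 0 :=
      one_sub_ne_zero_of_norm (norm_mul_pow_lt hq hq _)
    have f1 : q * q ^ (R + 1 + d + R + 1) = q ^ (R + 1) * q ^ (R + 1) * (q * q ^ d) := by ring
    have f2 : q ^ (R + 1 + d + 1) = q ^ (R + 1) * (q * q ^ d) := by ring
    rw [f1] at h4 ⊢
    rw [f2, pow_add q (R + 1) ((R + 1).choose 2), pow_succ (-1 : ℂ) R]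
    generalize q ^ (R + 1) = x at *
    generalize q * q ^ d = y at *
    generalize q ^ (R + 1).choose 2 = t at *
    have h5 : 1 - y * x ^ 2 ≠ 0 := by convert h4 using 1; ring
    field_simp
    ring

theorem sum_alternating {q : ℂ} (hq : ‖q‖ < 1) (N : ℕ) :
    ∑ r ∈ range (N + 1), (-1) ^ (r + 1) * q ^ (r + 1).choose 2 * (1 + q ^ (r + 1)) /
        (poch q q (N - r) * poch q q (N + 2 + r)) = - 1 / poch q q (N + 1) ^ 2 := by
  have hN : 1 - q * q ^ N ≠ 0 := one_sub_ne_zero_of_norm (norm_mul_pow_lt hq hq _)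
  have h := sum_alternating_aux hq N N le_rfl
  rw [sum_range_succ]
  have h1 := poch_ne_zero hq hq N
  have h2 := poch_ne_zero hq hq (N + 1 + N)
  have h4 : 1 - q * q ^ (N + 1 + N) ≠ 0 := one_sub_ne_zero_of_norm (norm_mul_pow_lt hq hq _)
  have e4 : N + 2 + N = N + 1 + N + 1 := by omega
  have f1 : q * q ^ (N + 1 + N) = (q * q ^ N) * (q * q ^ N) := by ring
  have f2 : q ^ (N + 1) = q * q ^ N := by ring
  simp only [Nat.sub_self, poch_zero] at h ⊢
  rw [poch_succ q q N, f2] at h ⊢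
  rw [f1] at h4
  rw [e4, poch_succ q q (N + 1 + N), f1, pow_succ (-1 : ℂ) N]
  generalize (∑ r ∈ range N, (-1) ^ (r + 1) * q ^ (r + 1).choose 2 * (1 + q ^ (r + 1)) /
        (poch q q (N - r) * poch q q (N + 2 + r))) = S at *
  have hS : S = ((-1) ^ N * q ^ (N + 1).choose 2 / (1 * poch q q (N + 1 + N)) -
        1 / (poch q q N * (poch q q N * (1 - q * q ^ N)))) / (1 - q * q ^ N) := by
    rw [eq_div_iff hN, h]
  rw [hS]
  generalize q * q ^ N = y at *
  have h5 : 1 + y ≠ 0 := fun h0 => h4 (by linear_combination (1 - y) * h0)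
  have h6 : 1 - y * y = (1 - y) * (1 + y) := by ring
  rw [h6]
  field_simp
  ring

/-- Induction on n: multiplying the right side by (1 - zq^n)(1 - wq^n) must give the right side for
n - 1. Since zw = 1, this factor equals (1 - q^{n-r})(1 - q^{n+r}) + q^{n-r}(1 - zq^r)(1 - wq^r).
The first summand lowers n; the second cancels the denominator of α_r, and what remains sums to zero
by `sum_alternating`. -/
theorem bailey_pair {z w q : ℂ} (hzw : z * w = 1) (hz : ‖z‖ = 1) (hw : ‖w‖ = 1) (hq : ‖q‖ < 1)
    (n : ℕ) :
    (poch (z * q) q n * poch (w * q) q n)⁻¹ =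
      ∑ r ∈ range (n + 1), baileyAlpha z w q r / (poch q q (n - r) * poch q q (n + r)) := by
  have hne : ∀ v : ℂ, ‖v‖ = 1 → ∀ r : ℕ, 1 - v * q ^ (r + 1) ≠ 0 := fun v hv r => by
    refine one_sub_ne_zero_of_norm ?_
    rw [norm_mul, hv, one_mul, norm_pow]
    exact pow_lt_one₀ (norm_nonneg q) hq (by omega)
  induction n with
  | zero => simp [baileyAlpha]
  | succ N ih =>
    set n := N + 1 with hn
    have hDz := hne z hz N
    have hDw := hne w hw N
    have key : (1 - z * q ^ n) * (1 - w * q ^ n) *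
        (∑ r ∈ range (n + 1), baileyAlpha z w q r / (poch q q (n - r) * poch q q (n + r))) =
        ∑ r ∈ range (N + 1), baileyAlpha z w q r / (poch q q (N - r) * poch q q (N + r)) := by
      have h1 : ∀ r ∈ range (N + 1), (1 - z * q ^ n) * (1 - w * q ^ n) *
          (baileyAlpha z w q r / (poch q q (n - r) * poch q q (n + r))) =
          baileyAlpha z w q r / (poch q q (N - r) * poch q q (N + r)) +
          baileyAlpha z w q r * ((1 - z * q ^ r) * (1 - w * q ^ r)) * q ^ (n - r) /
            (poch q q (n - r) * poch q q (n + r)) := fun r hr => by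
        have hr' : r ≤ N := by simpa [Nat.lt_succ_iff] using hr
        obtain ⟨d, rfl⟩ : ∃ d, N = r + d := ⟨N - r, by omega⟩
        have e1 : n - r = d + 1 := by omega
        have e2 : r + d - r = d := by omega
        have e3 : n + r = r + d + r + 1 := by omega
        rw [e1, e2, e3, poch_succ q q d, poch_succ q q (r + d + r)]
        have k1 := poch_ne_zero hq hq d
        have k2 := poch_ne_zero hq hq (r + d + r)
        have k3 : 1 - q * q ^ d ≠ 0 := one_sub_ne_zero_of_norm (norm_mul_pow_lt hq hq _)
        have k4 : 1 - q * q ^ (r + d + r) ≠ 0 := one_sub_ne_zero_of_norm (norm_mul_pow_lt hq hq _)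
        have f1 : q * q ^ (r + d + r) = q ^ r * q ^ r * (q * q ^ d) := by ring
        have f2 : q ^ n = q ^ r * (q * q ^ d) := by rw [hn]; ring
        have f3 : q ^ (d + 1) = q * q ^ d := by ring
        rw [f1] at k4 ⊢
        rw [f2, f3]
        generalize q * q ^ d = y at *
        generalize q ^ r = x at *
        have k5 : 1 - x ^ 2 * y ≠ 0 := by convert k4 using 1; ring
        field_simp
        linear_combination (x ^ 2 * y ^ 2 - y * x ^ 2) * baileyAlpha z w q r * hzw
      rw [mul_sum, sum_range_succ, sum_congr rfl h1, sum_add_distrib, add_assoc, add_eq_left]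
      have h2 : (1 - z * q ^ n) * (1 - w * q ^ n) *
          (baileyAlpha z w q n / (poch q q (n - n) * poch q q (n + n))) =
          baileyAlpha z w q n * ((1 - z * q ^ n) * (1 - w * q ^ n)) * q ^ (n - n) /
            (poch q q (n - n) * poch q q (n + n)) := by
        rw [Nat.sub_self, pow_zero]
        ring
      -- The top term r = n has no counterpart for n - 1 and joins the leftover terms; r = 0 is then
      -- split off because α_0 is not given by the general formula.
      rw [h2, ← hn, ← sum_range_succ (fun r => baileyAlpha z w q r *
        ((1 - z * q ^ r) * (1 - w * q ^ r)) * q ^ (n - r) / (poch q q (n - r) * poch q q (n + r))),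
        sum_range_succ']
      have h3 : ∀ r ∈ range n, baileyAlpha z w q (r + 1) *
          ((1 - z * q ^ (r + 1)) * (1 - w * q ^ (r + 1))) * q ^ (n - (r + 1)) /
            (poch q q (n - (r + 1)) * poch q q (n + (r + 1))) =
          (1 - z) * (1 - w) * q ^ n * ((-1) ^ (r + 1) * q ^ (r + 1).choose 2 * (1 + q ^ (r + 1)) /
            (poch q q (N - r) * poch q q (N + 2 + r))) := fun r hr => by
        have hr' : r < n := by simpa using hr
        have k1 := hne z hz r
        have k2 := hne w hw r
        have e1 : n - (r + 1) = N - r := by omega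
        have e2 : n + (r + 1) = N + 2 + r := by omega
        have e3 : q ^ n = q ^ (r + 1) * q ^ (N - r) := by rw [← pow_add]; congr 1; omega
        rw [baileyAlpha, if_neg (Nat.succ_ne_zero r), div_mul_cancel₀ _ (mul_ne_zero k1 k2), e1, e2,
          e3, choose_two_succ (r + 1), pow_add q (r + 1) ((r + 1).choose 2)]
        ring
      rw [sum_congr rfl h3, ← mul_sum, hn, sum_alternating hq N]
      simp only [baileyAlpha, if_true, pow_zero, Nat.sub_zero, add_zero]
      ring
    rw [ih.symm] at key
    have hz' : poch (z * q) q n = poch (z * q) q N * (1 - z * q ^ n) := by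
      rw [hn, poch_succ]; ring
    have hw' : poch (w * q) q n = poch (w * q) q N * (1 - w * q ^ n) := by
      rw [hn, poch_succ]; ring
    rw [hz', hw']
    have hD : (1 - z * q ^ n) * (1 - w * q ^ n) ≠ 0 := mul_ne_zero hDz hDw
    rw [mul_mul_mul_comm, mul_inv, ← key, mul_comm, inv_mul_cancel_left₀ hD]

/-- The 8 bounds the three factors 1 + q^r, 1 - z, 1 - w by 2 each; for r ≥ 1 both denominators are
at least 1 - |q|. -/
theorem norm_baileyAlpha_le {z w q : ℂ} (hz : ‖z‖ = 1) (hw : ‖w‖ = 1) (hq : ‖q‖ < 1) (r : ℕ) :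
    ‖baileyAlpha z w q r‖ ≤ 8 / (1 - ‖q‖) ^ 2 * ‖q‖ ^ r := by
  have h0 : 0 < 1 - ‖q‖ := by linarith
  have hq0 := norm_nonneg q
  rcases r with _ | r
  · simp only [baileyAlpha, if_true, norm_one, pow_zero, mul_one]
    rw [le_div_iff₀ (by positivity)]
    nlinarith
  · have hden : ∀ v : ℂ, ‖v‖ = 1 → 1 - ‖q‖ ≤ ‖1 - v * q ^ (r + 1)‖ := fun v hv => by
      have h1 := norm_sub_norm_le (1 : ℂ) (v * q ^ (r + 1))
      rw [norm_one, norm_mul, hv, one_mul, norm_pow] at h1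
      have h2 : ‖q‖ ^ (r + 1) ≤ ‖q‖ := pow_le_of_le_one hq0 hq.le (by omega)
      linarith
    have hnum : ∀ v : ℂ, ‖v‖ = 1 → ‖1 - v‖ ≤ 2 := fun v hv => by
      have h1 := norm_sub_le (1 : ℂ) v
      rw [norm_one, hv] at h1
      linarith
    have hadd : ‖1 + q ^ (r + 1)‖ ≤ 2 := by
      have h1 := norm_add_le (1 : ℂ) (q ^ (r + 1))
      rw [norm_one, norm_pow] at h1
      have h2 : ‖q‖ ^ (r + 1) ≤ 1 := pow_le_one₀ hq0 hq.le
      linarith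
    have hpow : ‖q‖ ^ (r + 1 + 1).choose 2 ≤ ‖q‖ ^ (r + 1) :=
      pow_le_pow_of_le_one hq0 hq.le (by rw [choose_two_succ]; omega)
    rw [baileyAlpha, if_neg (Nat.succ_ne_zero r), norm_div, norm_mul, norm_mul, norm_mul, norm_mul,
      norm_mul, norm_pow, norm_pow, norm_neg, norm_one, one_pow, one_mul, div_mul_eq_mul_div]
    refine div_le_div₀ (by positivity) ?_ (by positivity) ?_
    · calc _ ≤ ‖q‖ ^ (r + 1) * 2 * (2 * 2) := by
            gcongr
            · exact hnum z hz
            · exact hnum w hw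
        _ = _ := by ring
    · rw [sq]
      exact mul_le_mul (hden z hz) (hden w hw) h0.le (norm_nonneg _)

theorem summable_norm_baileyAlpha {z w q : ℂ} (hz : ‖z‖ = 1) (hw : ‖w‖ = 1) (hq : ‖q‖ < 1) :
    Summable fun r => ‖baileyAlpha z w q r‖ :=
  Summable.of_nonneg_of_le (fun _ => norm_nonneg _) (norm_baileyAlpha_le hz hw hq)
    ((summable_geometric_of_lt_one (norm_nonneg q) hq).mul_left _)

theorem norm_unit_mul_lt {z q : ℂ} (hz : ‖z‖ = 1) (hq : ‖q‖ < 1) : ‖z * q‖ < 1 := by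
  rwa [norm_mul, hz, one_mul]

/-- This is the limit n → ∞ of `bailey_pair`, taken inside the sum by dominated convergence. -/
theorem hasSum_baileyAlpha {z w q : ℂ} (hzw : z * w = 1) (hz : ‖z‖ = 1) (hw : ‖w‖ = 1)
    (hq : ‖q‖ < 1) :
    HasSum (baileyAlpha z w q) (qPoch q q ^ 2 / (qPoch (z * q) q * qPoch (w * q) q)) := by
  obtain ⟨B, hB⟩ := exists_norm_inv_poch_le hq hq
  have hB0 : 0 ≤ B := (norm_nonneg _).trans (hB 0)
  have hQ := qPoch_ne_zero hq hq
  have hs := summable_norm_baileyAlpha hz hw hq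
  have hlim : Tendsto (fun n => ∑' r, if r ≤ n then
      baileyAlpha z w q r / (poch q q (n - r) * poch q q (n + r)) else 0) atTop
      (𝓝 (∑' r, baileyAlpha z w q r / (qPoch q q * qPoch q q))) := by
    refine tendsto_tsum_of_dominated_convergence
      (bound := fun r => B * B * ‖baileyAlpha z w q r‖) (hs.mul_left _) (fun r => ?_)
      (Eventually.of_forall fun n r => ?_)
    · have h1 : Tendsto (fun n => baileyAlpha z w q r / (poch q q (n - r) * poch q q (n + r)))
          atTop (𝓝 (baileyAlpha z w q r / (qPoch q q * qPoch q q))) :=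
        tendsto_const_nhds.div (((tendsto_poch q hq).comp (tendsto_sub_atTop_nat r)).mul
          ((tendsto_poch q hq).comp (tendsto_add_atTop_nat r))) (mul_ne_zero hQ hQ)
      refine h1.congr' ?_
      filter_upwards [eventually_ge_atTop r] with n hn
      rw [if_pos hn]
    · split_ifs
      · rw [div_eq_mul_inv, mul_inv, norm_mul, norm_mul, mul_comm]
        exact mul_le_mul_of_nonneg_right (mul_le_mul (hB _) (hB _) (norm_nonneg _) hB0)
          (norm_nonneg _)
      · rw [norm_zero]
        positivity
  have heq : ∀ n, (∑' r, if r ≤ n then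
      baileyAlpha z w q r / (poch q q (n - r) * poch q q (n + r)) else 0) =
      (poch (z * q) q n * poch (w * q) q n)⁻¹ := fun n => by
    rw [bailey_pair hzw hz hw hq, tsum_eq_sum (s := range (n + 1))]
    · exact sum_congr rfl fun r hr => if_pos (by simpa [Nat.lt_succ_iff] using hr)
    · intro r hr
      exact if_neg (by simpa using hr)
  simp only [heq] at hlim
  have hz' := qPoch_ne_zero (norm_unit_mul_lt hz hq) hq
  have hw' := qPoch_ne_zero (norm_unit_mul_lt hw hq) hq
  have hlim' := ((tendsto_poch (z * q) hq).mul (tendsto_poch (w * q) hq)).inv₀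
    (mul_ne_zero hz' hw')
  have h := tendsto_nhds_unique hlim hlim'
  rw [tsum_div_const, div_eq_iff (mul_ne_zero hQ hQ)] at h
  have : qPoch q q ^ 2 / (qPoch (z * q) q * qPoch (w * q) q) = ∑' r, baileyAlpha z w q r := by
    rw [h]
    ring
  rw [this]
  exact hs.of_norm.hasSum

/-- An instance of Bailey's lemma: insert `bailey_pair`, write n = r + m and exchange summations.
For fixed r the sum over m is Cauchy's Durfee rectangle sum with k = 2r. -/
theorem hasSum_durfee_square {z w q : ℂ} (hzw : z * w = 1) (hz : ‖z‖ = 1) (hw : ‖w‖ = 1)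
    (hq : ‖q‖ < 1) :
    HasSum (fun n => q ^ n ^ 2 / (poch (z * q) q n * poch (w * q) q n))
      ((∑' r, baileyAlpha z w q r * q ^ r ^ 2) / qPoch q q) := by
  obtain ⟨B, hB⟩ := exists_norm_inv_poch_le hq hq
  have hB0 : 0 ≤ B := (norm_nonneg _).trans (hB 0)
  have hq0 := norm_nonneg q
  set F : ℕ × ℕ → ℂ := fun p =>
    baileyAlpha z w q p.1 / (poch q q p.2 * poch q q (p.2 + 2 * p.1)) * q ^ (p.1 + p.2) ^ 2 with hF
  have hsum : Summable F := by
    refine Summable.of_norm_bounded (g := fun p => ‖baileyAlpha z w q p.1‖ *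
      (B * B * ‖q‖ ^ p.2)) ((summable_norm_baileyAlpha hz hw hq).mul_of_nonneg
        ((summable_geometric_of_lt_one hq0 hq).mul_left (B * B)) (fun _ => norm_nonneg _)
        (fun _ => by positivity)) fun p => ?_
    simp only [hF]
    rw [div_eq_mul_inv, mul_inv, norm_mul, norm_mul, norm_mul, norm_pow, mul_assoc]
    refine mul_le_mul_of_nonneg_left (mul_le_mul (mul_le_mul (hB _) (hB _) (norm_nonneg _) hB0)
      (pow_le_pow_of_le_one hq0 hq.le ?_) (by positivity) (by positivity)) (norm_nonneg _)
    nlinarith [Nat.le_self_pow two_ne_zero (p.1 + p.2)]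
  have hrow : ∀ r, HasSum (fun m => F (r, m)) (baileyAlpha z w q r * q ^ r ^ 2 / qPoch q q) :=
    fun r => by
      have h := (hasSum_durfee hq (2 * r)).mul_left (baileyAlpha z w q r * q ^ r ^ 2)
      rw [← div_eq_mul_inv] at h
      refine h.congr_fun fun m => ?_
      simp only [hF]
      have : (r + m) ^ 2 = r ^ 2 + (m ^ 2 + 2 * r * m) := by ring
      rw [this, pow_add q (r ^ 2)]
      ring
  have h1 := (hsum.hasSum.prod_fiberwise hrow).tsum_eq
  rw [tsum_div_const] at h1
  have h2 := (Finset.HasAntidiagonal.sigmaAntidiagonalEquivProd.hasSum_iff.mpr hsum.hasSum).sigma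
    fun n => hasSum_fintype _
  rw [← h1] at h2
  refine h2.congr_fun fun n => ?_
  rw [div_eq_mul_inv, bailey_pair hzw hz hw hq, mul_sum,
    ← Finset.Nat.sum_antidiagonal_eq_sum_range_succ
      (fun r m => q ^ n ^ 2 * (baileyAlpha z w q r / (poch q q m * poch q q (n + r)))) n,
    ← Finset.sum_coe_sort]
  refine sum_congr rfl fun p _ => ?_
  have hp : p.1.1 + p.1.2 = n := mem_antidiagonal.mp p.2
  have hp2 : p.1.2 + 2 * p.1.1 = n + p.1.1 := by omega
  simp only [hF, Function.comp_apply, Finset.HasAntidiagonal.sigmaAntidiagonalEquivProd_apply, hp, hp2]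
  ring

/-! ### The Rogers–Fine identity -/

theorem summable_pow_div_poch {b t q : ℂ} (hb : ‖b‖ < 1) (ht : ‖t‖ < 1) (hq : ‖q‖ < 1) :
    Summable fun n => t ^ n / poch b q n := by
  obtain ⟨B, hB⟩ := exists_norm_inv_poch_le hb hq
  refine Summable.of_norm_bounded (g := fun n => ‖t‖ ^ n * B)
    ((summable_geometric_of_lt_one (norm_nonneg t) ht).mul_right _) fun n => ?_
  rw [div_eq_mul_inv, norm_mul, norm_pow]
  exact mul_le_mul_of_nonneg_left (hB n) (by positivity)

/-- Termwise this is 1/(b)_{n+1} - 1/(b)_n = b q^n/(b)_{n+1}, together with (b)_{n+1} = (1 -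
b)(bq)_n. -/
theorem fine_functional_equation {b t q : ℂ} (hb : ‖b‖ < 1) (ht : ‖t‖ < 1) (hq : ‖q‖ < 1) :
    (1 - t) * ∑' n, t ^ n / poch b q n =
      1 + b * t / (1 - b) * ∑' n, (t * q) ^ n / poch (b * q) q n := by
  have htq : ‖t * q‖ < 1 := by simpa using norm_mul_pow_lt ht hq 1
  have hbq : ‖b * q‖ < 1 := by simpa using norm_mul_pow_lt hb hq 1
  have s1 := summable_pow_div_poch hb ht hq
  have s2 := summable_pow_div_poch hbq htq hq
  have e1 := s1.tsum_eq_zero_add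
  have k1 := ((summable_nat_add_iff 1).mpr s1).hasSum
  have k2 := s1.hasSum.mul_left t
  have k3 := s2.hasSum.mul_left (b * t / (1 - b))
  have k := (k1.sub k2).sub k3
  have k0 : ∀ n, t ^ (n + 1) / poch b q (n + 1) - t * (t ^ n / poch b q n) -
      b * t / (1 - b) * ((t * q) ^ n / poch (b * q) q n) = 0 := fun n => by
    have h1 := poch_ne_zero hb hq n
    have h2 := one_sub_ne_zero_of_norm (norm_mul_pow_lt hb hq n)
    have h3 := one_sub_ne_zero_of_norm hb
    have h4 := poch_ne_zero hbq hq n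
    have h5 : b * t / (1 - b) * ((t * q) ^ n / poch (b * q) q n) =
        b * t * (t * q) ^ n / poch b q (n + 1) := by
      rw [poch_succ', div_mul_div_comm]
    rw [h5, poch_succ, mul_pow]
    generalize q ^ n = x at *
    field_simp
    ring
  simp only [k0] at k
  have h := k.unique hasSum_zero
  simp only [pow_zero, poch_zero, div_one] at e1
  linear_combination e1 + h

/-- The Rogers–Fine identity (case `α = 0`). -/
theorem hasSum_rogersFine {b t q : ℂ} (hb : ‖b‖ < 1) (ht : ‖t‖ < 1) (hq : ‖q‖ < 1) :
    HasSum (fun n => (b * t) ^ n * q ^ (2 * n.choose 2) / (poch b q n * poch t q (n + 1)))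
      (∑' n, t ^ n / poch b q n) := by
  obtain ⟨A, hA⟩ := exists_norm_poch_le b hq
  obtain ⟨B, hB⟩ := exists_norm_inv_poch_le hb hq
  obtain ⟨C, hC⟩ := exists_norm_inv_poch_le ht hq
  have hA0 : 0 ≤ A := (norm_nonneg _).trans (hA 0)
  have hB0 : 0 ≤ B := (norm_nonneg _).trans (hB 0)
  have hC0 : 0 ≤ C := (norm_nonneg _).trans (hC 0)
  have hbt : ‖b * t‖ < 1 := by
    rw [norm_mul]
    exact mul_lt_one_of_nonneg_of_lt_one_left (norm_nonneg _) hb ht.le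
  have hterm : ∀ n m, ‖(b * t) ^ n * q ^ (2 * n.choose 2) / (poch b q n * poch t q m)‖ ≤
      ‖b * t‖ ^ n * (B * C) := fun n m => by
    rw [div_eq_mul_inv, mul_inv, norm_mul, norm_mul, norm_mul, norm_pow, norm_pow]
    exact mul_le_mul (mul_le_of_le_one_right (by positivity) (pow_le_one₀ (norm_nonneg q) hq.le))
      (mul_le_mul (hB n) (hC m) (norm_nonneg _) hB0) (by positivity) (by positivity)
  have hgeo : Summable fun n : ℕ => ‖b * t‖ ^ n * (B * C) :=
    (summable_geometric_of_lt_one (norm_nonneg _) hbt).mul_right _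
  have hsum : Summable fun n =>
      (b * t) ^ n * q ^ (2 * n.choose 2) / (poch b q n * poch t q (n + 1)) :=
    Summable.of_norm_bounded hgeo fun n => hterm n (n + 1)
  set f : ℕ → ℂ := fun N => ∑' n, (t * q ^ N) ^ n / poch (b * q ^ N) q n with hf
  -- Iterate the functional equation along (b, t) → (bq, tq). Step j contributes the factor b t
  -- q^{2j}, whence the exponent 2·C(n,2).
  have hiter : ∀ N, f 0 = (∑ n ∈ range N,
      (b * t) ^ n * q ^ (2 * n.choose 2) / (poch b q n * poch t q (n + 1))) +
      (b * t) ^ N * q ^ (2 * N.choose 2) / (poch b q N * poch t q N) * f N := fun N => by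
    induction N with
    | zero => simp
    | succ N ih =>
      have h := fine_functional_equation (norm_mul_pow_lt hb hq N) (norm_mul_pow_lt ht hq N) hq
      have e1 : (∑' n, (t * q ^ N * q) ^ n / poch (b * q ^ N * q) q n) = f (N + 1) := by
        simp only [hf, pow_succ, mul_assoc]
      have e2 : (∑' n, (t * q ^ N) ^ n / poch (b * q ^ N) q n) = f N := rfl
      rw [e1, e2] at h
      rw [ih, sum_range_succ, choose_two_succ, add_assoc, add_right_inj, poch_succ t, poch_succ b]
      have h1 := poch_ne_zero hb hq N
      have h2 := poch_ne_zero ht hq N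
      have h3 := one_sub_ne_zero_of_norm (norm_mul_pow_lt hb hq N)
      have h4 := one_sub_ne_zero_of_norm (norm_mul_pow_lt ht hq N)
      have hfN : f N = (1 + b * q ^ N * (t * q ^ N) / (1 - b * q ^ N) * f (N + 1)) /
          (1 - t * q ^ N) := by
        rw [eq_div_iff h4, ← h]
        ring
      rw [hfN, mul_add 2 N, pow_add q (2 * N), two_mul N, pow_add q N, pow_succ (b * t)]
      generalize q ^ N = x at *
      field_simp
  have hrem : Tendsto (fun N => (b * t) ^ N * q ^ (2 * N.choose 2) / (poch b q N * poch t q N) *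
      f N) atTop (𝓝 0) := by
    have hfb : ∀ N, ‖f N‖ ≤ ∑' n : ℕ, ‖t‖ ^ n * (A * B) := fun N => by
      refine tsum_of_norm_bounded
        ((summable_geometric_of_lt_one (norm_nonneg t) ht).mul_right (A * B)).hasSum fun n => ?_
      -- Writing the shifted symbol as a quotient of unshifted ones makes the bound uniform in N.
      have h1 : (poch (b * q ^ N) q n)⁻¹ = poch b q N * (poch b q (N + n))⁻¹ := by
        have h2 : poch b q (N + n) = poch b q N * poch (b * q ^ N) q n := by
          simp only [poch]
          rw [prod_range_add]
          congr 1
          exact prod_congr rfl fun j _ => by ring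
        rw [h2, mul_inv, mul_inv_cancel_left₀ (poch_ne_zero hb hq N)]
      rw [div_eq_mul_inv, h1, norm_mul, norm_mul, norm_pow]
      refine mul_le_mul (pow_le_pow_left₀ (norm_nonneg _) ?_ n)
        (mul_le_mul (hA N) (hB _) (norm_nonneg _) hA0) (by positivity) (by positivity)
      rw [norm_mul, norm_pow]
      exact mul_le_of_le_one_right (norm_nonneg t) (pow_le_one₀ (norm_nonneg q) hq.le)
    refine squeeze_zero_norm (a := fun N => ‖b * t‖ ^ N * (B * C) *
      ∑' n : ℕ, ‖t‖ ^ n * (A * B)) (fun N => ?_) ?_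
    · rw [norm_mul]
      exact mul_le_mul (hterm N N) (hfb N) (norm_nonneg _) (by positivity)
    · simpa using hgeo.tendsto_atTop_zero.mul_const (∑' n : ℕ, ‖t‖ ^ n * (A * B))
  have hf0 : f 0 = ∑' n, t ^ n / poch b q n := by simp [hf]
  rw [← hf0]
  have hlim := hsum.hasSum.tendsto_sum_nat.add hrem
  have := tendsto_nhds_unique (tendsto_const_nhds.congr hiter) hlim
  rw [this, add_zero]
  exact hsum.hasSum

/-- The sum over the largest part equals the sum over Durfee squares. -/
theorem hasSum_largest_part_series {z w q : ℂ} (hzw : z * w = 1) (hz : ‖z‖ = 1) (hw : ‖w‖ = 1)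
    (hq : ‖q‖ < 1) :
    HasSum (fun L => z ^ L * q ^ (L + 1) / poch (w * q) q (L + 1))
      ((∑' r, baileyAlpha z w q r * q ^ r ^ 2) / qPoch q q - 1) := by
  have hzq := norm_unit_mul_lt hz hq
  have hwq := norm_unit_mul_lt hw hq
  have hwq2 : ‖w * q * q‖ < 1 := by simpa using norm_mul_pow_lt hwq hq 1
  -- Rogers–Fine with b = wq², t = zq, so that bt = q³. The result is the Durfee square series
  -- without its n = 0 term, which accounts for the -1.
  have h1 := (hasSum_rogersFine hwq2 hzq hq).mul_left (q / (1 - w * q))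
  have h2 := (summable_pow_div_poch hwq2 hzq hq).hasSum.mul_left (q / (1 - w * q))
  have h3 := (hasSum_nat_add_iff' 1).mpr (hasSum_durfee_square hzw hz hw hq)
  simp only [range_one, sum_singleton, poch_zero, mul_one, div_one, ne_eq, OfNat.ofNat_ne_zero,
    not_false_eq_true, zero_pow, pow_zero] at h3
  have h4 : ∀ n, q / (1 - w * q) * ((w * q * q * (z * q)) ^ n * q ^ (2 * n.choose 2) /
      (poch (w * q * q) q n * poch (z * q) q (n + 1))) =
      q ^ (n + 1) ^ 2 / (poch (z * q) q (n + 1) * poch (w * q) q (n + 1)) := fun n => by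
    have e1 : w * q * q * (z * q) = q ^ 3 := by linear_combination q ^ 3 * hzw
    have e2 : (n + 1) ^ 2 = 1 + 3 * n + 2 * n.choose 2 := by
      induction n with
      | zero => simp
      | succ n ih => rw [choose_two_succ]; linarith
    rw [e1, e2, poch_succ' (w * q), div_mul_div_comm, ← pow_mul, pow_add, pow_add, pow_one]
    congr 1 <;> ring
  simp only [h4] at h1
  rw [h1.unique h3] at h2
  refine h2.congr_fun fun L => ?_
  rw [poch_succ' (w * q), div_mul_div_comm, mul_pow]
  congr 1
  ring

/-! ### Generating functions over multisets of parts -/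

/-- The multiplicative weight of a multiset of parts. -/
def weight (x : ℕ → ℂ) (m : Multiset ℕ) : ℂ := (m.map x).prod

theorem weight_congr {x y : ℕ → ℂ} {m : Multiset ℕ} (h : ∀ i ∈ m, x i = y i) :
    weight x m = weight y m := by
  rw [weight, weight, Multiset.map_congr rfl h]

theorem weight_eq_zero {x : ℕ → ℂ} {m : Multiset ℕ} {i : ℕ} (hi : i ∈ m) (hx : x i = 0) :
    weight x m = 0 :=
  Multiset.prod_eq_zero (Multiset.mem_map.mpr ⟨i, hi, hx⟩)

theorem weight_eq_count_mul (x : ℕ → ℂ) (a : ℕ) (m : Multiset ℕ) :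
    weight x m = x a ^ m.count a * weight x (m.filter (· ≠ a)) := by
  conv_lhs => rw [weight, ← Multiset.filter_add_not (· = a) m]
  rw [Multiset.map_add, Multiset.prod_add, Multiset.filter_eq', Multiset.map_replicate,
    Multiset.prod_replicate, weight]

theorem norm_weight (x : ℕ → ℂ) (m : Multiset ℕ) :
    ‖weight x m‖ = (m.map fun i => ‖x i‖).prod := by
  induction m using Multiset.induction_on with
  | empty => simp [weight]
  | cons a m ih =>
    rw [weight] at ih ⊢
    rw [Multiset.map_cons, Multiset.prod_cons, norm_mul, ih, Multiset.map_cons, Multiset.prod_cons]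

/-- A multiset is determined by the multiplicity of `a` and the remaining parts. Giving `a` weight 0
in the second factor kills exactly the pairs that do not arise this way. -/
theorem hasSum_count_mul {x : ℕ → ℂ} {g : ℕ → ℂ} {a : ℕ} {S G : ℂ}
    (hS : HasSum (weight (Function.update x a 0)) S) (hG : HasSum g G) :
    HasSum (fun m : Multiset ℕ => g (m.count a) * weight x (m.filter (· ≠ a))) (G * S) := by
  set x' := Function.update x a 0 with hx'
  have hprod : HasSum (fun p : ℕ × Multiset ℕ => g p.1 * weight x' p.2) (G * S) :=
    hG.mul hS (summable_mul_of_summable_norm hG.summable.norm hS.summable.norm)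
  have hinj : Function.Injective
      fun m : Multiset ℕ => (m.count a, m.filter (· ≠ a)) := fun m m' h => by
    simp only [Prod.mk.injEq] at h
    rw [← Multiset.filter_add_not (· = a) m, ← Multiset.filter_add_not (· = a) m',
      Multiset.filter_eq', Multiset.filter_eq', h.1, h.2]
  refine ((hinj.hasSum_iff fun p hp => ?_).mpr hprod).congr_fun fun m => ?_
  · by_cases ha : a ∈ p.2
    · rw [weight_eq_zero ha (by simp [hx']), mul_zero]
    · refine absurd ⟨p.2 + Multiset.replicate p.1 a, ?_⟩ hp
      have h1 : Multiset.filter (· ≠ a) p.2 = p.2 :=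
        Multiset.filter_eq_self.mpr fun b hb hba => ha (hba ▸ hb)
      have h2 : Multiset.filter (· ≠ a) (Multiset.replicate p.1 a) = 0 :=
        Multiset.filter_eq_nil.mpr fun b hb => by simp [Multiset.eq_of_mem_replicate hb]
      simp only [Multiset.count_add, Multiset.count_replicate_self, Multiset.filter_add, h1, h2,
        Multiset.count_eq_zero_of_notMem ha, zero_add, add_zero]
  · simp only [Function.comp_apply]
    congr 1
    refine weight_congr fun i hi => ?_
    rw [hx', Function.update_of_ne (Multiset.mem_filter.mp hi).2]

theorem hasSum_weight_finset {x : ℕ → ℂ} (hx : ∀ i, ‖x i‖ < 1) (s : Finset ℕ) :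
    HasSum (weight fun i => if i ∈ s then x i else 0) (∏ i ∈ s, (1 - x i))⁻¹ := by
  induction s using Finset.induction_on with
  | empty =>
    simp only [notMem_empty, if_false, prod_empty, inv_one]
    have h := hasSum_single (f := weight fun _ => 0) 0 fun m hm => by
      obtain ⟨i, hi⟩ := Multiset.exists_mem_of_ne_zero hm
      exact weight_eq_zero hi rfl
    simpa [weight] using h
  | insert a s ha ih =>
    have h1 : Function.update (fun i => if i ∈ insert a s then x i else 0) a 0 =
        fun i => if i ∈ s then x i else 0 := by
      ext i
      rcases eq_or_ne i a with rfl | hi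
      · simp [ha]
      · simp [hi]
    rw [← h1] at ih
    rw [prod_insert ha, mul_inv]
    refine (hasSum_count_mul ih (hasSum_geometric_of_norm_lt_one (hx a))).congr_fun fun m => ?_
    rw [weight_eq_count_mul _ a]
    simp

theorem prod_one_sub_tendsto {x : ℕ → ℂ} (hs : Summable fun i => ‖x i‖) :
    Tendsto (fun n => ∏ i ∈ range n, (1 - x i)) atTop (𝓝 (∏' i, (1 - x i))) := by
  have h : Multipliable fun i => 1 + -x i := multipliable_one_add_of_summable (by simpa using hs)
  simpa [← sub_eq_add_neg] using h.hasProd.tendsto_prod_nat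

theorem tprod_one_sub_ne_zero {x : ℕ → ℂ} (hx : ∀ i, ‖x i‖ < 1) (hs : Summable fun i => ‖x i‖) :
    ∏' i, (1 - x i) ≠ 0 := by
  have h := tprod_one_add_ne_zero_of_summable (f := fun i => -x i)
    (fun i => by
      rw [← sub_eq_add_neg]
      exact one_sub_ne_zero_of_norm (hx i)) (by simpa using hs)
  simpa [sub_eq_add_neg] using h

theorem exists_forall_mem_lt (T : Finset (Multiset ℕ)) : ∃ N, ∀ m ∈ T, ∀ i ∈ m, i < N := by
  refine ⟨T.sup (fun m => m.sup) + 1, fun m hm i hi => Nat.lt_succ_iff.mpr ?_⟩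
  exact (Multiset.le_sup hi).trans (Finset.le_sup (f := fun m : Multiset ℕ => m.sup) hm)

/-- Finitely many multisets involve finitely many parts, so each partial sum is at most a finite
product of 1/(1 - |x_i|). These products converge, hence are bounded. -/
theorem summable_norm_weight {x : ℕ → ℂ} (hx : ∀ i, ‖x i‖ < 1) (hs : Summable fun i => ‖x i‖) :
    Summable fun m => ‖weight x m‖ := by
  set y : ℕ → ℂ := fun i => (‖x i‖ : ℂ) with hy
  have hyn : ∀ i, ‖y i‖ = ‖x i‖ := fun i => by simp [hy]
  have hy1 : ∀ i, ‖y i‖ < 1 := fun i => (hyn i).trans_lt (hx i)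
  have hys : Summable fun i => ‖y i‖ := by simpa only [hyn] using hs
  obtain ⟨C, hC⟩ := ((prod_one_sub_tendsto hys).inv₀
    (tprod_one_sub_ne_zero hy1 hys)).norm.bddAbove_range
  refine summable_of_sum_le (c := C) (fun _ => norm_nonneg _) fun T => ?_
  obtain ⟨N, hN⟩ := exists_forall_mem_lt T
  have hfin := hasSum_weight_finset hy1 (range N)
  have hre : ∀ m, weight (fun i => if i ∈ range N then y i else 0) m =
      (((m.map fun i => if i ∈ range N then ‖x i‖ else 0).prod : ℝ) : ℂ) := fun m => by
    rw [weight, ← Complex.ofRealHom_eq_coe, map_multiset_prod, Multiset.map_map]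
    congr 1
    refine Multiset.map_congr rfl fun i _ => ?_
    simp only [Function.comp_apply, hy]
    split_ifs <;> simp
  have hpos : ∀ m : Multiset ℕ, 0 ≤ (m.map fun i => if i ∈ range N then ‖x i‖ else 0).prod :=
    fun m => Multiset.prod_nonneg fun a ha => by
      obtain ⟨i, _, rfl⟩ := Multiset.mem_map.mp ha
      split_ifs <;> simp
  have hsr := Complex.hasSum_re (hfin.congr_fun fun m => (hre m).symm)
  simp only [Complex.ofReal_re] at hsr
  calc ∑ m ∈ T, ‖weight x m‖
      = ∑ m ∈ T, (m.map fun i => if i ∈ range N then ‖x i‖ else 0).prod := by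
        refine sum_congr rfl fun m hm => ?_
        rw [norm_weight]
        congr 1
        exact Multiset.map_congr rfl fun i hi => by rw [if_pos (mem_range.mpr (hN m hm i hi))]
    _ ≤ _ := sum_le_hasSum T (fun m _ => hpos m) hsr
    _ ≤ _ := Complex.re_le_norm _
    _ ≤ C := hC ⟨N, rfl⟩

/-- The generating function of all multisets of parts, by multiplicative weight. -/
theorem hasSum_weight {x : ℕ → ℂ} (hx : ∀ i, ‖x i‖ < 1) (hs : Summable fun i => ‖x i‖) :
    HasSum (weight x) (∏' i, (1 - x i))⁻¹ := by
  have hw := summable_norm_weight hx hs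
  have h1 : Tendsto (fun N => ∑' m, weight (fun i => if i ∈ range N then x i else 0) m) atTop
      (𝓝 (∑' m, weight x m)) := by
    refine tendsto_tsum_of_dominated_convergence hw (fun m => ?_)
      (Eventually.of_forall fun N m => ?_)
    · obtain ⟨N, hN⟩ := exists_forall_mem_lt {m}
      refine tendsto_const_nhds.congr' ?_
      filter_upwards [eventually_ge_atTop N] with n hn
      exact weight_congr fun i hi =>
        (if_pos (mem_range.mpr ((hN m (mem_singleton_self m) i hi).trans_le hn))).symm
    · by_cases h : ∀ i ∈ m, i ∈ range N
      · rw [weight_congr (y := x) fun i hi => if_pos (h i hi)]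
      · push Not at h
        obtain ⟨i, hi, hiN⟩ := h
        rw [weight_eq_zero hi (if_neg hiN), norm_zero]
        exact norm_nonneg _
  simp only [(hasSum_weight_finset hx (range _)).tsum_eq] at h1
  rw [← tendsto_nhds_unique h1 ((prod_one_sub_tendsto hs).inv₀ (tprod_one_sub_ne_zero hx hs))]
  exact hw.of_norm.hasSum

theorem hasSum_fiber {β : Type*} {F : β → ℂ} (k : β → ℕ) {a : ℕ → ℂ} (hF : Summable F)
    (h : ∀ L, HasSum (fun m => if k m = L then F m else 0) (a L)) :
    HasSum a (∑' m, F m) := by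
  have h1 := (Equiv.sigmaFiberEquiv k).hasSum_iff.mpr hF.hasSum
  refine h1.sigma fun L => ?_
  have h2 : HasSum (Set.indicator {m | k m = L} F) (a L) := by
    refine (h L).congr_fun fun m => ?_
    simp [Set.indicator_apply]
  exact (hasSum_subtype_iff_indicator).mpr h2

/-- Partitions are the multisets without the part 0, so a weight vanishing on multisets that contain
0 loses nothing. -/
theorem hasSum_partition {F : Multiset ℕ → ℂ} {S : ℂ} (h0 : ∀ m, 0 ∈ m → F m = 0)
    (h : HasSum F S) : HasSum (fun n : ℕ => ∑ p : n.Partition, F p.parts) S := by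
  have hinj : Function.Injective fun p : (Σ n, Nat.Partition n) => p.2.parts := by
    rintro ⟨n, p⟩ ⟨n', p'⟩ hp
    obtain rfl : n = n' := by rw [← p.parts_sum, ← p'.parts_sum]; exact congrArg _ hp
    obtain rfl : p = p' := Nat.Partition.ext hp
    rfl
  have h1 : HasSum (fun p : (Σ n, Nat.Partition n) => F p.2.parts) S := by
    refine (hinj.hasSum_iff fun m hm => ?_).mpr h
    by_contra hne
    exact hm ⟨⟨m.sum, m, fun {i} hi => Nat.pos_of_ne_zero fun hi0 => hne (h0 m (hi0 ▸ hi)), rfl⟩,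
      rfl⟩
  exact h1.sigma fun n => hasSum_fintype _

/-- Summing over the multisets of parts by largest part. -/
theorem hasSum_sup_pow_mul_weight {x : ℕ → ℂ} (hx0 : x 0 = 0) (hx : ∀ i, ‖x i‖ < 1)
    (hs : Summable fun i => ‖x i‖) {z S : ℂ} (hz : ‖z‖ = 1)
    (hS : HasSum (fun L => z ^ (L + 1) * (x (L + 1) / ∏ i ∈ range (L + 2), (1 - x i))) S) :
    HasSum (fun m : Multiset ℕ => z ^ m.sup * weight x m) (1 + S) := by
  have hsum : Summable fun m : Multiset ℕ => z ^ m.sup * weight x m := by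
    refine Summable.of_norm ((summable_norm_weight hx hs).congr fun m => ?_)
    rw [norm_mul, norm_pow, hz, one_pow, one_mul]
  -- Multisets with parts at most L have a finite product as generating function. Differences of
  -- consecutive products isolate those with largest part exactly L.
  have hle : ∀ L, HasSum (fun m : Multiset ℕ => if m.sup ≤ L then weight x m else 0)
      (∏ i ∈ range (L + 1), (1 - x i))⁻¹ := fun L => by
    refine (hasSum_weight_finset hx (range (L + 1))).congr_fun fun m => ?_
    split_ifs with h
    · exact weight_congr fun i hi =>
        (if_pos (mem_range.mpr (Nat.lt_succ_iff.mpr ((Multiset.le_sup hi).trans h)))).symm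
    · rw [Multiset.sup_le] at h
      push Not at h
      obtain ⟨i, hi, hL⟩ := h
      rw [weight_eq_zero hi]
      rw [if_neg]
      simpa [Nat.lt_succ_iff] using hL
  set a : ℕ → ℂ := fun L => if L = 0 then 1 else
    z ^ L * (x L / ∏ i ∈ range (L + 1), (1 - x i)) with ha
  have hfib : ∀ L, HasSum (fun m : Multiset ℕ =>
      if m.sup = L then z ^ m.sup * weight x m else 0) (a L) := fun L => by
    rcases L with _ | L
    · have h := hle 0
      simp only [zero_add, range_one, prod_singleton, hx0, sub_zero, inv_one,
        Nat.le_zero] at h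
      simp only [ha, if_true]
      refine h.congr_fun fun m => ?_
      split_ifs with hm <;> simp [hm]
    · have h := ((hle (L + 1)).sub (hle L)).mul_left (z ^ (L + 1))
      have e : z ^ (L + 1) * ((∏ i ∈ range (L + 1 + 1), (1 - x i))⁻¹ -
          (∏ i ∈ range (L + 1), (1 - x i))⁻¹) = a (L + 1) := by
        simp only [ha, Nat.succ_ne_zero, if_false]
        rw [prod_range_succ _ (L + 1)]
        have h1 : 1 - x (L + 1) ≠ 0 := one_sub_ne_zero_of_norm (hx _)
        have h2 : ∏ i ∈ range (L + 1), (1 - x i) ≠ 0 :=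
          prod_ne_zero_iff.mpr fun i _ => one_sub_ne_zero_of_norm (hx i)
        field_simp
        ring
      rw [e] at h
      refine h.congr_fun fun m => ?_
      rcases lt_trichotomy m.sup (L + 1) with hm | hm | hm
      · rw [if_neg hm.ne, if_pos hm.le, if_pos (Nat.lt_succ_iff.mp hm), sub_self, mul_zero]
      · rw [if_pos hm, if_pos hm.le, if_neg (by omega), sub_zero, hm]
      · rw [if_neg hm.ne', if_neg (by omega), if_neg (by omega), sub_self, mul_zero]
  have h1 := hasSum_fiber (fun m : Multiset ℕ => m.sup) hsum hfib
  have h2 : HasSum a (1 + S) := by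
    have h3 := (hasSum_nat_add_iff (f := a) (g := S) 1).mp (by simpa [ha] using hS)
    simpa [ha, add_comm] using h3
  rw [← h1.unique h2]
  exact hsum.hasSum

theorem norm_le_of_eq_zero_or {x : ℕ → ℂ} {q : ℂ}
    (h : ∀ i, x i = 0 ∨ i ≠ 0 ∧ ‖x i‖ = ‖q‖ ^ i) (hq : ‖q‖ < 1) :
    (∀ i, ‖x i‖ < 1) ∧ Summable fun i => ‖x i‖ := by
  constructor
  · intro i
    rcases h i with h0 | ⟨hi, h1⟩
    · simp [h0]
    · rw [h1]
      exact pow_lt_one₀ (norm_nonneg q) hq hi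
  · refine Summable.of_nonneg_of_le (fun _ => norm_nonneg _) (fun i => ?_)
      (summable_geometric_of_lt_one (norm_nonneg q) hq)
    rcases h i with h0 | ⟨_, h1⟩
    · simp [h0]
    · exact h1.le

theorem weight_mul_pow (w q : ℂ) (m : Multiset ℕ) :
    weight (fun i => w * q ^ i) m = w ^ Multiset.card m * q ^ m.sum := by
  rw [weight, Multiset.prod_map_mul, Multiset.map_const', Multiset.prod_replicate]
  congr 1
  induction m using Multiset.induction_on with
  | empty => simp
  | cons a m ih => rw [Multiset.map_cons, Multiset.prod_cons, ih, Multiset.sum_cons, pow_add]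

/-! ### The rank generating function and sixth roots of unity -/

/-- The rank generating function at roots of unity. -/
theorem hasSum_rank {z w q : ℂ} (hzw : z * w = 1) (hz : ‖z‖ = 1) (hw : ‖w‖ = 1)
    (hq : ‖q‖ < 1) :
    HasSum (fun n : ℕ => ∑ p : n.Partition,
        z ^ largestPart p * (w ^ Multiset.card p.parts * q ^ n))
      ((∑' r, baileyAlpha z w q r * q ^ r ^ 2) / qPoch q q) := by
  -- Each part carries w = z⁻¹, so together with z to the largest part the exponent of z is the
  -- rank.
  set x : ℕ → ℂ := fun i => if i = 0 then 0 else w * q ^ i with hx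
  obtain ⟨hx1, hxs⟩ := norm_le_of_eq_zero_or (x := x) (q := q) (fun i => by
    rcases eq_or_ne i 0 with hi | hi
    · exact Or.inl (by simp [hx, hi])
    · exact Or.inr ⟨hi, by simp [hx, hi, hw]⟩) hq
  have hprod : ∀ L, ∏ i ∈ range (L + 2), (1 - x i) = poch (w * q) q (L + 1) := fun L => by
    rw [prod_range_succ', poch]
    simp only [hx, Nat.succ_ne_zero, if_false, if_true, sub_zero, mul_one]
    exact prod_congr rfl fun j _ => by ring
  have h := hasSum_sup_pow_mul_weight (z := z) (by simp [hx]) hx1 hxs hz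
    ((hasSum_largest_part_series hzw hz hw hq).congr_fun fun L => by
      rw [hprod]
      simp only [hx, Nat.succ_ne_zero, if_false]
      rw [← mul_div_assoc]
      congr 1
      linear_combination z ^ L * q ^ (L + 1) * hzw)
  rw [add_sub_cancel] at h
  refine (hasSum_partition (fun m hm => ?_) h).congr_fun fun n => sum_congr rfl fun p _ => ?_
  · rw [weight_eq_zero hm (by simp [hx]), mul_zero]
  · rw [weight_congr (y := fun i => w * q ^ i) fun i hi => if_neg (p.parts_pos hi).ne',
      weight_mul_pow, p.parts_sum]
    rfl

theorem rankSix_eq_sum (n : ℕ) :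
    rankSix n = ∑ p : n.Partition, if rank p % 6 ∈ ({0, 1, 5} : Finset ℤ) then 1 else -1 := by
  have h : ∀ t, rankCountMod t 6 n =
      ∑ p : n.Partition, if rank p ≡ t [ZMOD 6] then 1 else 0 := fun t => by
    rw [rankCountMod, card_filter]
    push_cast
    rfl
  simp only [rankSix, h]
  rw [sum_comm, sum_comm (s := {3, 2, -2}), ← sum_sub_distrib]
  refine sum_congr rfl fun p _ => ?_
  have h1 := Int.emod_nonneg (rank p) (show (6 : ℤ) ≠ 0 by norm_num)
  have h2 := Int.emod_lt_of_pos (rank p) (show (0 : ℤ) < 6 by norm_num)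
  simp only [Int.ModEq]
  obtain ⟨r, hr⟩ : ∃ r, rank p % 6 = r := ⟨_, rfl⟩
  simp only [hr] at h1 h2 ⊢
  clear hr
  interval_cases r <;> decide

/-- A primitive sixth root of unity. -/
theorem exists_sixth_root : ∃ z : ℂ, z ^ 2 = z - 1 := by
  refine ⟨⟨1 / 2, √3 / 2⟩, ?_⟩
  have h3 : √3 * √3 = 3 := Real.mul_self_sqrt (by norm_num)
  apply Complex.ext
  · simp [sq]
    linarith
  · simp [sq]
    ring

/-- The Fourier expansion on ℤ/6 of the sign that is + at 0, ±1 and - elsewhere. Here 1 - z = z⁻¹ =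
z⁵, and a + 5b replaces a - b to keep exponents natural. -/
theorem sixth_root_character {z : ℂ} (h : z ^ 2 = z - 1) (a b : ℕ) :
    2 * (z ^ a * (1 - z) ^ b) + 2 * ((1 - z) ^ a * z ^ b) - (-1) ^ a * (-1) ^ b =
      3 * ((if ((a : ℤ) - b) % 6 ∈ ({0, 1, 5} : Finset ℤ) then 1 else -1 : ℤ) : ℂ) := by
  have hz3 : z ^ 3 = -1 := by linear_combination (z + 1) * h
  have hz6 : z ^ 6 = 1 := by linear_combination (z ^ 3 - 1) * hz3
  have h1 : (1 - z) ^ 3 = -1 := by linear_combination (2 - z) * h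
  have hw6 : (1 - z) ^ 6 = 1 := by
    linear_combination ((1 - z) ^ 3 - 1) * h1
  have hm6 : (-1 : ℂ) ^ 6 = 1 := by norm_num
  have hz5 : z ^ 5 = 1 - z := by linear_combination z ^ 2 * hz3 - h
  obtain ⟨r, hr, k, hk⟩ : ∃ r : ℕ, r < 6 ∧ ∃ k, a + 5 * b = 6 * k + r :=
    ⟨(a + 5 * b) % 6, Nat.mod_lt _ (by norm_num), (a + 5 * b) / 6, by omega⟩
  have hmod : ((a : ℤ) - b) % 6 = r := by omega
  have e1 : z ^ a * (1 - z) ^ b = z ^ r := by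
    rw [← hz5, ← pow_mul, ← pow_add, hk, pow_add, pow_mul, hz6, one_pow, one_mul]
  have hw5 : (1 - z) ^ 5 = z := by
    have : z * (1 - z) = 1 := by linear_combination -h
    linear_combination z * hw6 - (1 - z) ^ 5 * this
  have e2 : (1 - z) ^ a * z ^ b = (1 - z) ^ r := by
    conv_lhs => rw [← hw5]
    have hwz : (1 - (1 - z) ^ 5) = 1 - z := by rw [hw5]
    rw [hwz, ← pow_mul, ← pow_add, hk, pow_add, pow_mul, hw6, one_pow, one_mul]
  have e3 : (-1 : ℂ) ^ a * (-1) ^ b = (-1) ^ r := by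
    have : (-1 : ℂ) ^ b = (-1) ^ (5 * b) := by rw [pow_mul]; norm_num
    rw [this, ← pow_add, hk, pow_add, pow_mul, hm6, one_pow, one_mul]
  rw [e1, e2, e3, hmod]
  interval_cases r
  · norm_num
  · norm_num
    ring
  · norm_num
    linear_combination 4 * h
  · norm_num
    linear_combination 6 * h
  · norm_num
    linear_combination 2 * z * hz3 + 2 * (1 - z) * h1
  · norm_num
    rw [hz5, hw5]
    ring

theorem hasSum_rankSix {q : ℂ} (hq : ‖q‖ < 1) :
    HasSum (fun n : ℕ => (rankSix n : ℂ) * q ^ n)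
      (qPoch (q ^ 3) (q ^ 3) ^ 2 / (qPoch q q * qPoch (-q ^ 3) (q ^ 3) ^ 2)) := by
  obtain ⟨z, h⟩ := exists_sixth_root
  have hzw : z * (1 - z) = 1 := by linear_combination -h
  have hz3 : z ^ 3 = -1 := by linear_combination (z + 1) * h
  have hz : ‖z‖ = 1 := by
    have h6 : z ^ 6 = 1 := by linear_combination (z ^ 3 - 1) * hz3
    exact Complex.norm_eq_one_of_pow_eq_one h6 (by norm_num)
  have hw : ‖1 - z‖ = 1 := by
    have := congrArg norm hzw
    rwa [norm_mul, hz, one_mul, norm_one] at this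
  have hm : ‖(-1 : ℂ)‖ = 1 := by simp
  have hq3 : ‖q ^ 3‖ < 1 := by
    rw [norm_pow]
    exact pow_lt_one₀ (norm_nonneg q) hq (by norm_num)
  -- By this symmetry ζ and ζ⁻¹ give the same series, so the coefficients 2/3 + 2/3 merge into 4/3.
  have hsw : ∀ r, baileyAlpha (1 - z) z q r = baileyAlpha z (1 - z) q r := fun r => by
    simp only [baileyAlpha]
    rw [mul_comm (1 - (1 - z)), mul_comm (1 - (1 - z) * q ^ r)]
  have h1 := hasSum_rank hzw hz hw hq
  have h2 := hasSum_rank (mul_comm z (1 - z) ▸ hzw) hw hz hq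
  have h3 := hasSum_rank (show (-1 : ℂ) * (-1) = 1 by norm_num) hm hm hq
  simp only [hsw] at h2
  have hq2 : ∀ r : ℕ, ‖q ^ r ^ 2‖ ≤ 1 := fun r => by
    rw [norm_pow]
    exact pow_le_one₀ (norm_nonneg q) hq.le
  have hs : ∀ a b : ℂ, ‖a‖ = 1 → ‖b‖ = 1 →
      Summable fun r => baileyAlpha a b q r * q ^ r ^ 2 := fun a b ha hb =>
    Summable.of_norm_bounded (summable_norm_baileyAlpha ha hb hq) fun r => by
      rw [norm_mul]
      exact mul_le_of_le_one_right (norm_nonneg _) (hq2 r)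
  have h4 := (((hs z (1 - z) hz hw).hasSum.mul_left (4 / 3)).sub
    ((hs (-1) (-1) hm hm).hasSum.mul_left (1 / 3)))
  have h5 := hasSum_baileyAlpha (show (-1 : ℂ) * (-1) = 1 by norm_num) hm hm hq3
  -- The crux. With y = q^r the factor (1-z)(1-w) is 1 at ζ and 4 at -1, and (4/3)(1/(1-y+y²) -
  -- 1/(1+y)²) = 4y/((1+y)²(1-y+y²)). The extra y completes the exponent C(r+1,2) + r² + r =
  -- 3·C(r+1,2).
  have hαeq : ∀ r, baileyAlpha (-1) (-1) (q ^ 3) r =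
      4 / 3 * (baileyAlpha z (1 - z) q r * q ^ r ^ 2) -
        1 / 3 * (baileyAlpha (-1) (-1) q r * q ^ r ^ 2) := fun r => by
    rcases r with _ | r
    · norm_num [baileyAlpha]
    · simp only [baileyAlpha, Nat.succ_ne_zero, if_false]
      have e : 3 * (r + 1 + 1).choose 2 = (r + 1 + 1).choose 2 + (r + 1) ^ 2 + (r + 1) := by
        induction r with
        | zero => decide
        | succ r ih => rw [choose_two_succ (r + 1 + 1)]; linarith
      have hlt : ‖q ^ (r + 1)‖ < 1 := by
        rw [norm_pow]
        exact pow_lt_one₀ (norm_nonneg q) hq (by omega)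
      rw [← pow_mul q 3, e, pow_add q _ (r + 1), pow_add q _ ((r + 1) ^ 2), ← pow_mul q 3,
        mul_comm 3 (r + 1), pow_mul q (r + 1) 3]
      generalize q ^ ((r + 1) ^ 2) = u
      generalize q ^ (r + 1 + 1).choose 2 = t
      generalize q ^ (r + 1) = y at *
      have d1 : 1 - -1 * y ≠ 0 := one_sub_ne_zero_of_norm (by simpa using hlt)
      have d2 : 1 - z * y ≠ 0 := one_sub_ne_zero_of_norm (by simpa [hz] using hlt)
      have d3 : 1 - (1 - z) * y ≠ 0 := one_sub_ne_zero_of_norm (by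
        rw [norm_mul, hw, one_mul]
        exact hlt)
      have e1 : (1 - z) * (1 - (1 - z)) = 1 := by linear_combination -h
      have e2 : (1 - z * y) * (1 - (1 - z) * y) = 1 - y + y ^ 2 := by
        linear_combination -y ^ 2 * h
      have d4 : 1 - y + y ^ 2 ≠ 0 := e2 ▸ mul_ne_zero d2 d3
      have d5 : 1 + y ≠ 0 := by simpa using d1
      have e3 : 1 - -1 * y ^ 3 = (1 + y) * (1 - y + y ^ 2) := by ring
      have e4 : 1 - -1 * y = 1 + y := by ring
      have e5 : 1 + y ^ 3 = (1 + y) * (1 - y + y ^ 2) := by ring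
      rw [e1, e2, e3, e4, e5]
      field_simp
      ring
  have h6 := h5.unique (h4.congr_fun hαeq)
  have h7 := (((h1.add h2).mul_left (2 / 3)).sub (h3.mul_left (1 / 3)))
  have hQ := qPoch_ne_zero hq hq
  have hval : qPoch (q ^ 3) (q ^ 3) ^ 2 / (qPoch q q * qPoch (-q ^ 3) (q ^ 3) ^ 2) =
      2 / 3 * ((∑' r, baileyAlpha z (1 - z) q r * q ^ r ^ 2) / qPoch q q +
        (∑' r, baileyAlpha z (1 - z) q r * q ^ r ^ 2) / qPoch q q) -
      1 / 3 * ((∑' r, baileyAlpha (-1) (-1) q r * q ^ r ^ 2) / qPoch q q) := by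
    rw [mul_comm (qPoch q q), ← div_div, sq (qPoch (-q ^ 3) (q ^ 3)), neg_eq_neg_one_mul (q ^ 3),
      h6]
    ring
  rw [hval]
  refine h7.congr_fun fun n => ?_
  rw [rankSix_eq_sum, Int.cast_sum, sum_mul, ← sum_add_distrib, mul_sum, mul_sum,
    ← sum_sub_distrib]
  refine sum_congr rfl fun p _ => ?_
  have := sixth_root_character h (largestPart p) (Multiset.card p.parts)
  rw [rank]
  linear_combination (-q ^ n / 3) * this

/-! ### The crank modulo 2 -/

/-- The parity sign of the crank of a multiset of parts. -/
noncomputable def crankSign (m : Multiset ℕ) : ℂ :=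
  if m.count 1 = 0 then (-1) ^ m.sup
  else (-1) ^ Multiset.card (m.filter fun i => m.count 1 < i) * (-1) ^ m.count 1

theorem neg_one_pow_mul_eq (a b : ℕ) : (-1 : ℂ) ^ a * (-1) ^ b =
    ((if (a : ℤ) - b ≡ 0 [ZMOD 2] then 1 else 0 : ℤ) -
      (if (a : ℤ) - b ≡ 1 [ZMOD 2] then 1 else 0 : ℤ) : ℤ) := by
  rw [← pow_add]
  rcases Nat.even_or_odd (a + b) with h | h
  · have h0 : (a : ℤ) - b ≡ 0 [ZMOD 2] := by
      have := Nat.even_iff.mp h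
      simp only [Int.ModEq]
      omega
    have h1 : ¬ (a : ℤ) - b ≡ 1 [ZMOD 2] := by
      simp only [Int.ModEq] at h0 ⊢
      omega
    rw [h.neg_one_pow, if_pos h0, if_neg h1]
    norm_num
  · have h1 : (a : ℤ) - b ≡ 1 [ZMOD 2] := by
      have := Nat.odd_iff.mp h
      simp only [Int.ModEq]
      omega
    have h0 : ¬ (a : ℤ) - b ≡ 0 [ZMOD 2] := by
      simp only [Int.ModEq] at h1 ⊢
      omega
    rw [h.neg_one_pow, if_pos h1, if_neg h0]
    norm_num

theorem crankSign_eq {n : ℕ} (p : n.Partition) : crankSign p.parts =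
    ((if crank p ≡ 0 [ZMOD 2] then 1 else 0 : ℤ) -
      (if crank p ≡ 1 [ZMOD 2] then 1 else 0 : ℤ) : ℤ) := by
  by_cases h : 1 ∉ p.parts
  · have hc : crank p = largestPart p - (0 : ℕ) := by simp [crank, h]
    have hs : crankSign p.parts = (-1) ^ largestPart p * (-1) ^ 0 := by
      rw [crankSign, if_pos (Multiset.count_eq_zero.mpr h), pow_zero, mul_one, largestPart]
    simp only [hs, hc, neg_one_pow_mul_eq]
  · have hc : crank p = (Multiset.card (p.parts.filter fun i => p.parts.count 1 < i) : ℤ) -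
        (p.parts.count 1 : ℤ) := by
      rw [crank, if_neg h]
    rw [crankSign, if_neg fun h0 => h (Multiset.count_eq_zero.mp h0)]
    simp only [hc, neg_one_pow_mul_eq]

theorem crankCountMod_eq_sum (t : ℤ) {n : ℕ} (hn : n ≠ 1) :
    crankCountMod t 2 n = ∑ p : n.Partition, if crank p ≡ t [ZMOD 2] then 1 else 0 := by
  have h := finsum_mem_eq_sum_filter (fun k => crankCount k n) {k : ℤ | k ≡ t [ZMOD 2]}
    (finite_support_crankCount n)
  rw [crankCountMod]
  refine h.trans ?_
  have hmem : ∀ p ∈ univ.filter (fun p : n.Partition => crank p ≡ t [ZMOD 2]),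
      crank p ∈ (finite_support_crankCount n).toFinset.filter
        (· ∈ {k : ℤ | k ≡ t [ZMOD 2]}) := fun p hp => by
    simp only [mem_filter, mem_univ, true_and] at hp
    simp only [mem_filter, Set.Finite.mem_toFinset, Function.mem_support, crankCount, if_neg hn,
      Set.mem_ofPred_eq]
    refine ⟨?_, hp⟩
    have : 0 < (univ.filter (fun p' : n.Partition => crank p' = crank p)).card :=
      card_pos.mpr ⟨p, by simp⟩
    exact_mod_cast this.ne'
  have hcard := card_eq_sum_card_fiberwise hmem
  have hl : (∑ p : n.Partition, if crank p ≡ t [ZMOD 2] then (1 : ℤ) else 0) =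
      ((univ.filter (fun p : n.Partition => crank p ≡ t [ZMOD 2])).card : ℤ) := by
    rw [card_filter]
    push_cast
    rfl
  rw [hl, hcard, Nat.cast_sum]
  refine sum_congr rfl fun k hk => ?_
  have hk' : k ≡ t [ZMOD 2] := (mem_filter.mp hk).2
  rw [crankCount, if_neg hn, filter_filter]
  congr 2
  ext p
  simp only [mem_filter, mem_univ, true_and]
  constructor
  · rintro rfl
    exact ⟨hk', rfl⟩
  · exact fun h => h.2

theorem crankTwo_one : crankTwo 1 = -3 := by
  have h0 : crankCountMod 0 2 1 = -1 := by
    rw [crankCountMod]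
    refine (finsum_mem_eq_sum_of_inter_support_eq (fun k => crankCount k 1)
      (s := {k : ℤ | k ≡ 0 [ZMOD 2]}) (t := {0}) ?_).trans (by simp [crankCount])
    ext k
    simp only [Set.mem_inter_iff, Set.mem_ofPred_eq, Function.mem_support, crankCount, if_true,
      coe_singleton, Set.mem_singleton_iff, Int.ModEq]
    split_ifs <;> simp <;> omega
  have h1 : crankCountMod 1 2 1 = 2 := by
    rw [crankCountMod]
    refine (finsum_mem_eq_sum_of_inter_support_eq (fun k => crankCount k 1)
      (s := {k : ℤ | k ≡ 1 [ZMOD 2]}) (t := {1, -1}) ?_).trans (by simp [crankCount])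
    ext k
    simp only [Set.mem_inter_iff, Set.mem_ofPred_eq, Function.mem_support, crankCount, if_true,
      coe_insert, coe_singleton, Set.mem_insert_iff, Set.mem_singleton_iff, Int.ModEq]
    split_ifs <;> simp <;> omega
  rw [crankTwo, h0, h1]
  norm_num

/-- The correction is the convention at n = 1: the partition {1} has crank sign -1, whereas M_(2)(1)
= -1 - 2 = -3. -/
theorem crankTwo_eq_sum (n : ℕ) :
    (crankTwo n : ℂ) = ∑ p : n.Partition, crankSign p.parts - if n = 1 then 2 else 0 := by
  by_cases hn : n = 1
  · subst hn
    rw [crankTwo_one, Fintype.sum_unique, if_pos rfl]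
    have : (default : Nat.Partition 1).parts = {1} := Nat.Partition.partition_one_parts _
    have h1 : Multiset.card (Multiset.filter (fun i => 1 < i) ({1} : Multiset ℕ)) = 0 := by decide
    rw [this, crankSign]
    norm_num [h1]
  · rw [if_neg hn, sub_zero, crankTwo, crankCountMod_eq_sum 0 hn, crankCountMod_eq_sum 1 hn,
      ← sum_sub_distrib, Int.cast_sum]
    exact sum_congr rfl fun p _ => (crankSign_eq p).symm

theorem norm_crankSign (m : Multiset ℕ) : ‖crankSign m‖ = 1 := by
  rw [crankSign]
  split_ifs <;> simp

theorem weight_pow (q : ℂ) (m : Multiset ℕ) : weight (fun i => q ^ i) m = q ^ m.sum := by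
  simpa using weight_mul_pow 1 q m

/-- Sum over the largest part and apply the q-binomial theorem with a = 0, t = -q. Removing its
terms n = 0, 1 and adding the empty partition leaves 2q, which later cancels the convention at n =
1. -/
theorem hasSum_crank_no_ones {q : ℂ} (hq : ‖q‖ < 1) :
    HasSum (fun m : Multiset ℕ => (-1) ^ m.sup * weight (fun i => if i ≤ 1 then 0 else q ^ i) m)
      ((1 - q) / qPoch (-q) q + 2 * q) := by
  set x : ℕ → ℂ := fun i => if i ≤ 1 then 0 else q ^ i with hx
  obtain ⟨hx1, hxs⟩ := norm_le_of_eq_zero_or (x := x) (q := q) (fun i => by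
    by_cases hi : i ≤ 1
    · exact Or.inl (by simp [hx, hi])
    · exact Or.inr ⟨by omega, by simp [hx, hi]⟩) hq
  have h1q : 1 - q ≠ 0 := one_sub_ne_zero_of_norm hq
  have hprod : ∀ L, (∏ i ∈ range (L + 2), (1 - x i)) * (1 - q) = poch q q (L + 1) := fun L => by
    induction L with
    | zero => simp [hx, prod_range_succ, poch]
    | succ L ih =>
      rw [prod_range_succ, mul_right_comm, ih, poch_succ q q (L + 1)]
      congr 1
      simp only [hx]
      rw [if_neg (by omega)]
      ring
  have hmq : ‖-q‖ < 1 := by rwa [norm_neg]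
  have h := (hasSum_nat_add_iff' 2).mpr (hasSum_qBinomial 0 hq hmq)
  have hp0 : ∀ n, poch 0 q n = 1 := fun n => by simp [poch]
  have hQ0 : qPoch 0 q = 1 := by simp [qPoch]
  simp only [hp0, zero_mul, hQ0, sum_range_succ, range_zero, sum_empty, poch_zero, poch_succ,
    pow_zero, pow_one, mul_one, one_mul, div_one, zero_add] at h
  have h2 := h.mul_left (1 - q)
  set a : ℕ → ℂ := fun L => (-1) ^ (L + 1) * (x (L + 1) / ∏ i ∈ range (L + 2), (1 - x i)) with ha
  have h3 : HasSum a ((1 - q) * (1 / qPoch (-q) q - (1 + 1 / (1 - q) * -q))) := by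
    rw [← hasSum_nat_add_iff' 1]
    have ha0 : ∑ i ∈ range 1, a i = 0 := by simp [ha, hx]
    rw [ha0, sub_zero]
    refine h2.congr_fun fun L => ?_
    have h4 : ∏ i ∈ range (L + 1 + 2), (1 - x i) = poch q q (L + 1 + 1) / (1 - q) :=
      eq_div_of_mul_eq h1q (hprod (L + 1))
    have h5 : poch q q L * (1 - q * q ^ L) * (1 - q * q ^ (L + 1)) = poch q q (L + 1 + 1) := by
      rw [poch_succ, poch_succ]
    have h6 := poch_ne_zero hq hq (L + 1 + 1)
    simp only [ha]
    rw [h4, h5]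
    have h7 : x (L + 1 + 1) = q ^ (L + 2) := by
      simp only [hx]
      rw [if_neg (by omega)]
    rw [h7, neg_pow q]
    field_simp
  have h8 := hasSum_sup_pow_mul_weight (z := -1) (by simp [hx]) hx1 hxs (by simp) h3
  convert h8 using 1
  field_simp
  ring

/-- Once the number of ones is fixed at k + 1, the crank sign is multiplicative: each part larger
than k + 1 contributes -1, so it gets weight -q^i. The product over the parts other than 1 is then
rewritten as a q-binomial coefficient. -/
theorem hasSum_crank_ones {q : ℂ} (hq : ‖q‖ < 1) (k : ℕ) :
    HasSum (fun m : Multiset ℕ => if m.count 1 = k + 1 then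
        crankSign m * weight (fun i => if i = 0 then 0 else q ^ i) m else 0)
      ((1 - q) / qPoch (-q) q * (poch (-q) q (k + 1) / poch q q (k + 1) * (-q) ^ (k + 1))) := by
  have hmq : ‖-q‖ < 1 := by rwa [norm_neg]
  have h1q : 1 - q ≠ 0 := one_sub_ne_zero_of_norm hq
  set x : ℕ → ℂ := fun i => if i = 0 then 0 else if i ≤ k + 1 then q ^ i else -q ^ i with hx
  set x' := Function.update x 1 0 with hx'
  have hx0' : ∀ i, i ≠ 1 → x' i = x i := fun i hi => by rw [hx', Function.update_of_ne hi]
  obtain ⟨hx1, hxs⟩ := norm_le_of_eq_zero_or (x := x') (q := q) (fun i => by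
    rcases eq_or_ne i 1 with rfl | h1
    · exact Or.inl (by simp [hx'])
    rw [hx0' i h1]
    rcases eq_or_ne i 0 with rfl | h0
    · exact Or.inl (by simp [hx])
    · refine Or.inr ⟨h0, ?_⟩
      simp only [hx, if_neg h0]
      split_ifs <;> simp) hq
  have hprod : ∀ j ≤ k, (∏ i ∈ range (j + 2), (1 - x' i)) * (1 - q) = poch q q (j + 1) :=
      fun j hj => by
    induction j with
    | zero => simp [hx, hx', prod_range_succ, poch]
    | succ j ih =>
      rw [prod_range_succ, mul_right_comm, ih (by omega), poch_succ q q (j + 1),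
        hx0' _ (by omega)]
      congr 1
      simp only [hx]
      rw [if_neg (by omega), if_pos (by omega)]
      ring
  have htail : (fun i => 1 - x' (i + (k + 2))) = fun i => 1 - -q * q ^ (k + 1) * q ^ i := by
    ext i
    rw [hx0' _ (by omega)]
    simp only [hx]
    rw [if_neg (by omega), if_neg (by omega)]
    ring
  have htprod : ∏' i, (1 - x' i) =
      poch q q (k + 1) / (1 - q) * qPoch (-q * q ^ (k + 1)) q := by
    have h1 := prod_one_sub_tendsto hxs
    rw [← tendsto_add_atTop_iff_nat (k + 2)] at h1
    refine tendsto_nhds_unique h1 ?_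
    refine ((tendsto_poch (-q * q ^ (k + 1)) hq).const_mul _).congr fun n => ?_
    rw [add_comm n, prod_range_add, ← hprod k le_rfl, mul_div_cancel_right₀ _ h1q]
    congr 1
    refine prod_congr rfl fun i _ => ?_
    rw [add_comm (k + 2) i]
    exact (congrFun htail i).symm
  have hS := hasSum_weight hx1 hxs
  -- The multiplicity of the part 1 is forced to be k + 1, and each 1 carries -q.
  have hG : HasSum (fun j => if j = k + 1 then (-q) ^ (k + 1) else 0) ((-q) ^ (k + 1)) :=
    hasSum_ite_eq _ _
  have h := hasSum_count_mul hS hG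
  have hval : (-q) ^ (k + 1) * (∏' i, (1 - x' i))⁻¹ =
      (1 - q) / qPoch (-q) q * (poch (-q) q (k + 1) / poch q q (k + 1) * (-q) ^ (k + 1)) := by
    have e := qPoch_eq_poch_mul (-q) hq (k + 1)
    have n1 := poch_ne_zero hq hq (k + 1)
    have n2 := poch_ne_zero hmq hq (k + 1)
    have n3 : qPoch (-q * q ^ (k + 1)) q ≠ 0 := qPoch_ne_zero (norm_mul_pow_lt hmq hq _) hq
    rw [htprod, e]
    generalize qPoch (-q * q ^ (k + 1)) q = Q at *
    field_simp
  rw [hval] at h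
  refine h.congr_fun fun m => ?_
  split_ifs with hm
  · rw [crankSign, if_neg (by omega), weight_eq_count_mul _ 1 m, hm, if_neg one_ne_zero, pow_one,
      neg_pow q]
    have key : weight x (m.filter (· ≠ 1)) =
        (-1) ^ Multiset.card (m.filter fun i => k + 1 < i) *
          weight (fun i => if i = 0 then 0 else q ^ i) (m.filter (· ≠ 1)) := by
      clear hm
      induction m using Multiset.induction_on with
      | empty => simp [weight]
      | cons a m ih =>
        by_cases ha : a = 1
        · subst ha
          rw [Multiset.filter_cons_of_neg _ (by simp), Multiset.filter_cons_of_neg _ (by simp), ih]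
        · rw [Multiset.filter_cons_of_pos (p := (· ≠ 1)) _ ha]
          simp only [weight, Multiset.map_cons, Multiset.prod_cons] at ih ⊢
          rw [ih]
          by_cases hk : k + 1 < a
          · rw [Multiset.filter_cons_of_pos _ hk, Multiset.card_cons]
            simp only [hx]
            rw [if_neg (by omega), if_neg (by omega), if_neg (by omega)]
            ring
          · rw [Multiset.filter_cons_of_neg _ hk]
            simp only [hx]
            rw [if_pos (show a ≤ k + 1 by omega)]
            ring
    rw [key]
    ring
  · rw [zero_mul]

theorem hasSum_crankTwo {q : ℂ} (hq : ‖q‖ < 1) :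
    HasSum (fun n : ℕ => (crankTwo n : ℂ) * q ^ n) (qPoch q q / qPoch (-q) q ^ 2) := by
  have hmq : ‖-q‖ < 1 := by rwa [norm_neg]
  have h1q : 1 - q ≠ 0 := one_sub_ne_zero_of_norm hq
  set y : ℕ → ℂ := fun i => if i = 0 then 0 else q ^ i with hy
  obtain ⟨hy1, hys⟩ := norm_le_of_eq_zero_or (x := y) (q := q) (fun i => by
    rcases eq_or_ne i 0 with hi | hi
    · exact Or.inl (by simp [hy, hi])
    · exact Or.inr ⟨hi, by simp [hy, hi]⟩) hq
  have hF : Summable fun m => crankSign m * weight y m :=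
    Summable.of_norm ((summable_norm_weight hy1 hys).congr fun m => by
      rw [norm_mul, norm_crankSign, one_mul])
  set a : ℕ → ℂ := fun k => if k = 0 then (1 - q) / qPoch (-q) q + 2 * q else
    (1 - q) / qPoch (-q) q * (poch (-q) q k / poch q q k * (-q) ^ k) with ha
  have hfib : ∀ k, HasSum (fun m : Multiset ℕ =>
      if m.count 1 = k then crankSign m * weight y m else 0) (a k) := fun k => by
    rcases k with _ | k
    · simp only [ha, if_true]
      refine (hasSum_crank_no_ones hq).congr_fun fun m => ?_
      split_ifs with hm
      · rw [crankSign, if_pos hm]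
        congr 1
        refine weight_congr fun i hi => ?_
        have hi1 : i ≠ 1 := fun h => Multiset.count_eq_zero.mp hm (h ▸ hi)
        simp only [hy]
        split_ifs <;> first | rfl | omega
      · rw [weight_eq_zero (Multiset.count_ne_zero.mp hm) (by simp),
          mul_zero]
    · simpa only [ha, Nat.succ_ne_zero, if_false] using hasSum_crank_ones hq k
  have h1 := hasSum_fiber (fun m : Multiset ℕ => m.count 1) hF hfib
  -- The q-binomial theorem with a = t = -q sums all fibres; its k = 0 term is the fibre without
  -- ones, up to the extra 2q.
  have h2 : HasSum a (2 * q + (1 - q) / qPoch (-q) q * (qPoch (-q * -q) q / qPoch (-q) q)) := by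
    have h3 := (hasSum_qBinomial (-q) hq hmq).mul_left ((1 - q) / qPoch (-q) q)
    refine ((hasSum_ite_eq 0 (2 * q)).add h3).congr_fun fun k => ?_
    simp only [ha]
    split_ifs with hk
    · subst hk
      simp
      ring
    · simp
  have h4 := h2.unique h1
  have h5 := hasSum_partition (fun m hm => by
    rw [weight_eq_zero hm (by simp [hy]), mul_zero]) (h4 ▸ hF.hasSum)
  have h6 := h5.sub (hasSum_ite_eq 1 (2 * q))
  have hval : qPoch q q / qPoch (-q) q ^ 2 =
      2 * q + (1 - q) / qPoch (-q) q * (qPoch (-q * -q) q / qPoch (-q) q) - 2 * q := by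
    have e := qPoch_eq_poch_mul q hq 1
    have e1 : -q * -q = q * q ^ 1 := by ring
    have e2 : poch q q 1 = 1 - q := by simp [poch]
    rw [e, e1, e2]
    ring
  rw [hval]
  refine h6.congr_fun fun n => ?_
  rw [crankTwo_eq_sum, sub_mul, sum_mul]
  congr 1
  · refine sum_congr rfl fun p _ => ?_
    rw [weight_congr (y := fun i => q ^ i) fun i hi => if_neg (p.parts_pos hi).ne', weight_pow,
      p.parts_sum]
  · split_ifs with hn <;> simp [hn]

/-! ### The product for p_3 and comparison of coefficients -/

theorem hasSum_pThree {q : ℂ} (hq : ‖q‖ < 1) :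
    HasSum (fun n : ℕ => (pThree n : ℂ) * q ^ n) (qPoch (q ^ 3) (q ^ 3) / qPoch q q) := by
  have hq3 : ‖q ^ 3‖ < 1 := by
    rw [norm_pow]
    exact pow_lt_one₀ (norm_nonneg q) hq (by norm_num)
  set x : ℕ → ℂ := fun i => if i % 3 = 0 then 0 else q ^ i with hx
  obtain ⟨hx1, hxs⟩ := norm_le_of_eq_zero_or (x := x) (q := q) (fun i => by
    by_cases hi : i % 3 = 0
    · exact Or.inl (by simp [hx, hi])
    · exact Or.inr ⟨fun h => hi (by simp [h]), by simp [hx, hi]⟩) hq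
  -- Restoring the factors at multiples of 3 gives back the full product (q)_{3n}.
  have hfin : ∀ n, (∏ i ∈ range (3 * n + 1), (1 - x i)) * poch (q ^ 3) (q ^ 3) n =
      poch q q (3 * n) := fun n => by
    induction n with
    | zero => simp [hx]
    | succ n ih =>
      have e0 : 3 * (n + 1) = 3 * n + 1 + 1 + 1 := by ring
      have e1 : x (3 * n + 1) = q ^ (3 * n + 1) := if_neg (by omega)
      have e2 : x (3 * n + 1 + 1) = q ^ (3 * n + 1 + 1) := if_neg (by omega)
      have e3 : x (3 * n + 1 + 1 + 1) = 0 := if_pos (by omega)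
      rw [e0, prod_range_succ, prod_range_succ, prod_range_succ, e1, e2, e3, poch_succ, poch_succ,
        poch_succ, poch_succ, ← ih]
      ring
  have h3n : Tendsto (fun n : ℕ => 3 * n) atTop atTop :=
    tendsto_atTop_mono (fun n => by simp only [id]; omega) tendsto_id
  have h3n1 : Tendsto (fun n : ℕ => 3 * n + 1) atTop atTop :=
    tendsto_atTop_mono (fun n => by simp only [id]; omega) tendsto_id
  have hprod : (∏' i, (1 - x i)) * qPoch (q ^ 3) (q ^ 3) = qPoch q q := by
    refine tendsto_nhds_unique ?_ ((tendsto_poch q hq).comp h3n)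
    refine Tendsto.congr hfin ?_
    exact ((prod_one_sub_tendsto hxs).comp h3n1).mul
      (tendsto_poch _ hq3)
  have hval : qPoch (q ^ 3) (q ^ 3) / qPoch q q = (∏' i, (1 - x i))⁻¹ := by
    have h1 := tprod_one_sub_ne_zero hx1 hxs
    have h2 := qPoch_ne_zero hq3 hq3
    rw [← hprod]
    field_simp
  rw [hval]
  refine (hasSum_partition (fun m hm => weight_eq_zero hm (by simp [hx]))
    (hasSum_weight hx1 hxs)).congr_fun fun n => ?_
  rw [pThree, card_filter]
  push_cast
  rw [sum_mul]
  refine sum_congr rfl fun p _ => ?_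
  split_ifs with h
  · rw [weight_congr (y := fun i => q ^ i) fun i hi => ?_, weight_pow, p.parts_sum, one_mul]
    have := h i hi
    simp only [Int.ModEq] at this
    exact if_neg (by omega)
  · push Not at h
    obtain ⟨i, hi, h1, h2⟩ := h
    simp only [Int.ModEq] at h1 h2
    rw [weight_eq_zero hi (if_pos (by omega)), zero_mul]

/-- The difference is a power series representing the zero function near 0, so its coefficients
vanish. -/
theorem eq_of_hasSum_eq {a b : ℕ → ℂ} {f : ℂ → ℂ}
    (ha : ∀ q : ℂ, ‖q‖ < 1 → HasSum (fun n => a n * q ^ n) (f q))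
    (hb : ∀ q : ℂ, ‖q‖ < 1 → HasSum (fun n => b n * q ^ n) (f q)) : a = b := by
  have h : HasFPowerSeriesAt (0 : ℂ → ℂ)
      (FormalMultilinearSeries.ofScalars ℂ fun n => a n - b n) 0 := by
    rw [hasFPowerSeriesAt_iff]
    filter_upwards [Metric.ball_mem_nhds (0 : ℂ) one_pos] with q hq
    have hq' : ‖q‖ < 1 := by simpa using hq
    have h1 := (ha q hq').sub (hb q hq')
    rw [sub_self] at h1
    refine h1.congr_fun fun n => ?_
    rw [FormalMultilinearSeries.coeff_ofScalars, smul_eq_mul]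
    ring
  have h0 := h.eq_zero
  ext n
  have h1 := FormalMultilinearSeries.coeff_ofScalars (𝕜 := ℂ) (p := fun n => a n - b n) (n := n)
  rw [h0] at h1
  exact sub_eq_zero.mp (by simpa [FormalMultilinearSeries.coeff] using h1.symm)

theorem hasSum_crankTwo_cube {q : ℂ} (hq : ‖q‖ < 1) :
    HasSum (fun n : ℕ => (crankTwo n : ℂ) * q ^ (3 * n))
      (qPoch (q ^ 3) (q ^ 3) / qPoch (-q ^ 3) (q ^ 3) ^ 2) := by
  have hq3 : ‖q ^ 3‖ < 1 := by
    rw [norm_pow]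
    exact pow_lt_one₀ (norm_nonneg q) hq (by norm_num)
  simpa only [pow_mul] using hasSum_crankTwo hq3

theorem rankSix_eq_convolution (n : ℕ) : rankSix n =
    ∑ k ∈ (Finset.range (n + 1)).filter (fun k => 3 * k ≤ n), crankTwo k * pThree (n - 3 * k) := by
  -- Spreading M_(2) over the multiples of 3 turns its series in q³ into an ordinary power series,
  -- ready for a Cauchy product with that of p_3.
  set c : ℕ → ℂ := fun i => if 3 ∣ i then (crankTwo (i / 3) : ℂ) else 0 with hc
  have hb : ∀ q : ℂ, ‖q‖ < 1 → HasSum (fun n => (∑ p ∈ antidiagonal n, c p.1 * pThree p.2) * q ^ n)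
      (qPoch (q ^ 3) (q ^ 3) ^ 2 / (qPoch q q * qPoch (-q ^ 3) (q ^ 3) ^ 2)) := fun q hq => by
    have h1 : HasSum (fun i => c i * q ^ i)
        (qPoch (q ^ 3) (q ^ 3) / qPoch (-q ^ 3) (q ^ 3) ^ 2) := by
      have hinj : Function.Injective fun n : ℕ => 3 * n := mul_right_injective₀ (by norm_num)
      refine (hinj.hasSum_iff fun i hi => ?_).mp ((hasSum_crankTwo_cube hq).congr_fun fun n => ?_)
      · have : ¬ 3 ∣ i := fun ⟨k, hk⟩ => hi ⟨k, hk.symm⟩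
        simp [hc, this]
      · simp [hc]
    have h2 := hasSum_pThree hq
    have hs := (summable_norm_sum_mul_antidiagonal_of_summable_norm h1.summable.norm
      h2.summable.norm).of_norm.hasSum
    rw [← tsum_mul_tsum_eq_tsum_sum_antidiagonal_of_summable_norm h1.summable.norm
      h2.summable.norm, h1.tsum_eq, h2.tsum_eq] at hs
    have hval : qPoch (q ^ 3) (q ^ 3) ^ 2 / (qPoch q q * qPoch (-q ^ 3) (q ^ 3) ^ 2) =
        qPoch (q ^ 3) (q ^ 3) / qPoch (-q ^ 3) (q ^ 3) ^ 2 *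
          (qPoch (q ^ 3) (q ^ 3) / qPoch q q) := by
      rw [div_mul_div_comm, ← sq, mul_comm (qPoch q q)]
    rw [hval]
    refine hs.congr_fun fun n => ?_
    rw [sum_mul]
    refine sum_congr rfl fun p hp => ?_
    rw [← mem_antidiagonal.mp hp, pow_add]
    ring
  have h := congrFun (eq_of_hasSum_eq (fun q hq => hasSum_rankSix hq) hb) n
  rw [Finset.Nat.sum_antidiagonal_eq_sum_range_succ (fun i j => c i * (pThree j : ℂ))] at h
  have h3 : ∑ i ∈ range n.succ, c i * (pThree (n - i) : ℂ) =
      ∑ k ∈ (Finset.range (n + 1)).filter (fun k => 3 * k ≤ n),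
        (crankTwo k : ℂ) * pThree (n - 3 * k) := by
    simp only [hc, ite_mul, zero_mul]
    rw [← sum_filter]
    refine sum_nbij' (· / 3) (3 * ·) ?_ ?_ ?_ ?_ ?_
    · intro i hi
      simp only [mem_filter, mem_range] at hi ⊢
      omega
    · intro k hk
      simp only [mem_filter, mem_range] at hk ⊢
      omega
    · intro i hi
      simp only [mem_filter] at hi
      exact Nat.mul_div_cancel' hi.2
    · intro k _
      exact Nat.mul_div_cancel_left k (by norm_num)
    · intro i hi
      simp only [mem_filter] at hi
      rw [Nat.mul_div_cancel' hi.2]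
  rw [h3] at h
  exact_mod_cast h

end RankCrank

theorem mainTheorem8 :
    (∀ q : ℂ, ‖q‖ < 1 →
      Summable (fun n : ℕ => (RankCrank.rankSix n : ℂ) * q ^ n) ∧
      Summable (fun n : ℕ => (RankCrank.crankTwo n : ℂ) * q ^ (3 * n)) ∧
      ∑' n : ℕ, (RankCrank.rankSix n : ℂ) * q ^ n =
        RankCrank.qPoch (q ^ 3) (q ^ 3) / RankCrank.qPoch q q *
          ∑' n : ℕ, (RankCrank.crankTwo n : ℂ) * q ^ (3 * n) ∧
      RankCrank.qPoch (q ^ 3) (q ^ 3) / RankCrank.qPoch q q *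
          ∑' n : ℕ, (RankCrank.crankTwo n : ℂ) * q ^ (3 * n) =
        RankCrank.qPoch (q ^ 3) (q ^ 3) ^ 2 /
          (RankCrank.qPoch q q * RankCrank.qPoch (-q ^ 3) (q ^ 3) ^ 2)) ∧
    (∀ n : ℕ, RankCrank.rankSix n =
      ∑ k ∈ (Finset.range (n + 1)).filter (fun k => 3 * k ≤ n),
        RankCrank.crankTwo k * RankCrank.pThree (n - 3 * k)) := by
  refine ⟨fun q hq => ?_, RankCrank.rankSix_eq_convolution⟩
  have hN := RankCrank.hasSum_rankSix hq
  have hM := RankCrank.hasSum_crankTwo_cube hq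
  have hprod : RankCrank.qPoch (q ^ 3) (q ^ 3) / RankCrank.qPoch q q *
      ∑' n : ℕ, (RankCrank.crankTwo n : ℂ) * q ^ (3 * n) =
      RankCrank.qPoch (q ^ 3) (q ^ 3) ^ 2 /
        (RankCrank.qPoch q q * RankCrank.qPoch (-q ^ 3) (q ^ 3) ^ 2) := by
    rw [hM.tsum_eq, div_mul_div_comm, sq (RankCrank.qPoch (q ^ 3) (q ^ 3))]
  exact ⟨hN.summable, hM.summable, hN.tsum_eq.trans hprod.symm, hprod⟩
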